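/- Consider the polynomial system $$\dot x=X(x,y)=\sum_{k=0}^n X_k(x,y),\qquad \dot y=Y(x,y)=\sum_{k=0}^n Y_k(x,y),\qquad (D)$$ where $X_k,Y_k$ are real homogeneous polynomials of degree $k$, $X_n$ and $Y_n$ are not both identically zero, and $X,Y$ are relatively prime. Call $(D)$ projectively singular if $xY_n(x,y)-yX_n(x,y)\equiv 0$. Identify the plane with the open unit hemisphere by the central projection $\kappa(x,y)=(x,y,1)/\sqrt{1+x^2+y^2}$; the closed hemisphere $\{(a,b,c): a^2+b^2+c^2=1,\ c\ge 0\}$ is the projective disc, and its equator $c=0$ is the boundary circle. Let $\Phi$ be the extension of $(D)$ to the projective disc: the vector field that is continuous on the closed hemisphere, not identically zero on the equator, and equal to $c^{\,j}\,d\kappa(X,Y)$ on the open hemisphere for some integer $j$ (these conditions determine $\Phi$). Trajectories of $(D)$ on the projective disc are the trajectories of $\Phi$ in the closed hemisphere, equilibria being counted as trajectories. The stereographically conjugate system $du/d\tau=U(u,v)$, $dv/d\tau=V(u,v)$ is the one obtained from $(D)$ by $x=4u/(u^2+v^2)$, $y=4v/(u^2+v^2)$ and $dt=(u^2+v^2)^m\,d\tau$,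 where $m\ge 0$ is the integer for which $U,V$ are polynomials that are not both divisible by $u^2+v^2$. The point at infinity $M_\infty$ of the extended plane corresponds to $(u,v)=(0,0)$ and, by definition, is a dicritical node of $(D)$ if $(0,0)$ is a dicritical node of this system. Here an equilibrium is called a dicritical node if, for one of the two directions of time, it is asymptotically stable, every nonconstant trajectory starting near it tends to it in a definite limit direction, and for each unit vector $e$ exactly one trajectory enters it in the direction $e$. Property. Suppose that $(D)$ is projectively singular and that every trajectory of $(D)$ on the projective disc that meets the boundary circle meets it orthogonally, that is, its velocity at the meeting point is nonzero and orthogonal to the circle (in particular, no point of the boundary circle is an equilibrium of $\Phi$). Then the stereographically conjugate system exists and $M_\infty$ is a dicritical node of $(D)$; in particular, it is an equilibrium. -/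

import Mathlib

open Filter Topology Set

noncomputable section

/-- The Euclidean plane. -/
abbrev Plane := EuclideanSpace ℝ (Fin 2)

/-- Euclidean three-space. -/
abbrev Space := EuclideanSpace ℝ (Fin 3)

/-! ### Polynomial systems in the plane -/

/-- The system `x' = P(x, y)`, `y' = Q(x, y)` has degree `n` (at least one of the two homogeneous
components of degree `n` is not identically zero) and `P`, `Q` have no common divisors other than
constants. -/
structure IsPolynomialSystem (n : ℕ) (P Q : MvPolynomial (Fin 2) ℝ) : Prop where
  degree_left : P.totalDegree ≤ n
  degree_right : Q.totalDegree ≤ n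
  top_ne_zero : MvPolynomial.homogeneousComponent n P ≠ 0 ∨
    MvPolynomial.homogeneousComponent n Q ≠ 0
  relPrime : IsRelPrime P Q

/-- The vector field `(x, y) ↦ (P(x, y), Q(x, y))`. -/
def planeField (P Q : MvPolynomial (Fin 2) ℝ) (z : Plane) : Plane :=
  !₂[MvPolynomial.eval (fun i => z i) P, MvPolynomial.eval (fun i => z i) Q]

/-- Projective singularity of a system of degree `n`: the polynomial
`W_n = x Q_n - y P_n` vanishes identically. -/
def IsProjectivelySingular (n : ℕ) (P Q : MvPolynomial (Fin 2) ℝ) : Prop :=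
  MvPolynomial.X 0 * MvPolynomial.homogeneousComponent n Q -
    MvPolynomial.X 1 * MvPolynomial.homogeneousComponent n P = 0

/-! ### The projective disc -/

/-- The projective disc, realized as the closed unit hemisphere (with its angles): its interior is
the image of the plane under the central projection. -/
def projectiveDisc : Set Space := {p | ‖p‖ = 1 ∧ 0 ≤ p 2}

/-- The boundary circle of the projective disc (the points at infinity). -/
def boundaryCircle : Set Space := {p | ‖p‖ = 1 ∧ p 2 = 0}

/-- The central projection of the plane (placed at height one) to the open unit hemisphere. -/
def centralProjection (z : Plane) : Space :=
  (Real.sqrt (1 + ‖z‖ ^ 2))⁻¹ • !₂[z 0, z 1, 1]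

/-- `Φ` is the extension of the system to the closed projective disc: on the interior it is the
image of the vector field under the central projection, multiplied by a (positive) power of the
height, which is a change of time; it is continuous up to the boundary circle; and it does not
vanish identically on that circle. These conditions determine `Φ` on the closed disc. -/
structure IsDiscExtension (P Q : MvPolynomial (Fin 2) ℝ) (Φ : Space → Space) : Prop where
  continuousOn : ContinuousOn Φ projectiveDisc
  interior : ∃ j : ℤ, ∀ z : Plane, Φ (centralProjection z) =
    (centralProjection z 2) ^ j • fderiv ℝ centralProjection z (planeField P Q z)
  boundary : ∃ p ∈ boundaryCircle, Φ p ≠ 0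

/-- `γ`, on the nondegenerate time interval `I`, is an arc of a trajectory of `Φ` in the closed
projective disc. Equilibria are trajectories: `γ` may be constant. -/
structure IsDiscTrajectory (Φ : Space → Space) (I : Set ℝ) (γ : ℝ → Space) : Prop where
  ordConnected : I.OrdConnected
  nontrivial : I.Nontrivial
  mapsTo : ∀ t ∈ I, γ t ∈ projectiveDisc
  solution : IsIntegralCurveOn γ (fun _ => Φ) I

/-- The tangent direction of the boundary circle at `(a, b, 0)`. -/
def circleTangent (p : Space) : Space := !₂[-p 1, p 0, 0]

/-- Every trajectory of the extended system that meets the boundary circle crosses it orthogonally: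
its velocity at the meeting point is nonzero and orthogonal to the circle. (In particular no
equilibrium lies on the circle.) -/
def MeetsBoundaryCircleOrthogonally (P Q : MvPolynomial (Fin 2) ℝ) : Prop :=
  ∃ Φ : Space → Space, IsDiscExtension P Q Φ ∧
    ∀ (I : Set ℝ) (γ : ℝ → Space), IsDiscTrajectory Φ I γ →
      ∀ t ∈ I, γ t ∈ boundaryCircle →
        derivWithin γ I t ≠ 0 ∧ inner ℝ (derivWithin γ I t) (circleTangent (γ t)) = 0

/-! ### The point at infinity -/

/-- The vector field obtained from the system by the transformation
`x = 4u / (u² + v²)`, `y = 4v / (u² + v²)` (used at `(u, v) ≠ (0, 0)` only). -/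
def bendixsonField (P Q : MvPolynomial (Fin 2) ℝ) (w : Plane) : Plane :=
  let F := planeField P Q ((4 / (w 0 ^ 2 + w 1 ^ 2)) • w)
  !₂[-((w 0 ^ 2 - w 1 ^ 2) / 4) * F 0 - (w 0 * w 1 / 2) * F 1,
    -(w 0 * w 1 / 2) * F 0 + ((w 0 ^ 2 - w 1 ^ 2) / 4) * F 1]

/-- `(U, V)` is the stereographically conjugate system: the transformed field is
`(U, V) / (u² + v²)^m` with polynomials `U`, `V` that are not both divisible by `u² + v²`.
This determines `m`, `U` and `V`; if the original polynomials are relatively prime, then so are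
`U` and `V`. -/
structure IsStereographicConjugate (P Q : MvPolynomial (Fin 2) ℝ) (m : ℕ)
    (U V : MvPolynomial (Fin 2) ℝ) : Prop where
  field_eq : ∀ w : Plane, w ≠ 0 →
    planeField U V w = ((w 0 ^ 2 + w 1 ^ 2) ^ m) • bendixsonField P Q w
  reduced : ¬ ((MvPolynomial.X 0 ^ 2 + MvPolynomial.X 1 ^ 2 : MvPolynomial (Fin 2) ℝ) ∣ U ∧
    (MvPolynomial.X 0 ^ 2 + MvPolynomial.X 1 ^ 2 : MvPolynomial (Fin 2) ℝ) ∣ V)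

/-- The (nonconstant) positive half-trajectory `γ` of `F` tends to `p` as `t → ∞`. -/
structure IsEnteringTrajectory (F : Plane → Plane) (p : Plane) (γ : ℝ → Plane) : Prop where
  solution : IsIntegralCurveOn γ (fun _ => F) (Ici 0)
  ne : ∀ t ∈ Ici (0 : ℝ), γ t ≠ p
  tendsto : Tendsto γ atTop (𝓝 p)

/-- `γ` reaches `p` (as `t → ∞`) in the direction of the vector `e`. -/
def HasLimitDirection (γ : ℝ → Plane) (p e : Plane) : Prop :=
  Tendsto (fun t => ‖γ t - p‖⁻¹ • (γ t - p)) atTop (𝓝 e)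

/-- A stable dicritical node: an asymptotically stable equilibrium such that every trajectory
near it enters it in a definite direction, and for every direction exactly one trajectory
enters it in that direction. -/
structure IsStableDicriticalNode (F : Plane → Plane) (p : Plane) : Prop where
  equilibrium : F p = 0
  node : ∀ N ∈ 𝓝 p, ∃ N' ∈ 𝓝 p, ∀ q ∈ N', q ≠ p →
    ∃ γ : ℝ → Plane, γ 0 = q ∧ IsEnteringTrajectory F p γ ∧ (∀ t ∈ Ici (0 : ℝ), γ t ∈ N) ∧
      ∃ e : Plane, ‖e‖ = 1 ∧ HasLimitDirection γ p e
  exists_direction : ∀ e : Plane, ‖e‖ = 1 →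
    ∃ γ : ℝ → Plane, IsEnteringTrajectory F p γ ∧ HasLimitDirection γ p e
  unique_direction : ∀ (e : Plane) (γ₁ γ₂ : ℝ → Plane),
    IsEnteringTrajectory F p γ₁ → HasLimitDirection γ₁ p e →
    IsEnteringTrajectory F p γ₂ → HasLimitDirection γ₂ p e →
    ∃ a ≥ (0 : ℝ), ∃ b ≥ (0 : ℝ), ∀ t ≥ (0 : ℝ), γ₁ (a + t) = γ₂ (b + t)

/-- A dicritical node: stable, or unstable (stable after reversal of time). -/
def IsDicriticalNode (F : Plane → Plane) (p : Plane) : Prop :=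
  IsStableDicriticalNode F p ∨ IsStableDicriticalNode (fun z => -F z) p

/-- The point at infinity `M_∞` of the extended plane is a dicritical node of the system: the
origin is a dicritical node of the stereographically conjugate system (which exists). -/
def IsDicriticalNodeAtInfinity (P Q : MvPolynomial (Fin 2) ℝ) : Prop :=
  (∃ (m : ℕ) (U V : MvPolynomial (Fin 2) ℝ), IsStereographicConjugate P Q m U V) ∧
    ∀ (m : ℕ) (U V : MvPolynomial (Fin 2) ℝ), IsStereographicConjugate P Q m U V →
      IsDicriticalNode (planeField U V) 0

end

/-! Let A = xP_n + yQ_n. Projective singularity makes the angular component of the homogenized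
system divisible by the homogenizing variable (`IsProjectivelySingular.angular_eq`). Hence, for r >
0 and |ω| = 1, the conjugate field at rω is r^d (-α ω + r β ω^⊥), where α and β are smooth up to r =
0 and α(0, ·) is a positive multiple of A.

Suppose A has no zero on the unit circle. After division by r^d the polar field is r' = -α, ω' = β
ω^⊥, which is transversal to the circle r = 0. Its orbits near the circle are graphs ω = Ω(r),
exactly one through each point of the circle. Blown down, they give exactly one trajectory for each
direction at the origin: a stable dicritical node if A > 0, an unstable one if A < 0
(`isStableDicriticalNode_of_polar_form`).

It remains to exclude zeros of A (`MeetsBoundaryCircleOrthogonally.radialPart_ne_zero`). The same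
divisibility shows that the extension Φ is the polynomial field `discField`, whose value at the
point ω of the equator has normal component -A(ω) and tangential component W(ω), where W = xQ_{n-1}
- yP_{n-1} (W = 0 if n = 0). Where A ≠ 0 a trajectory crosses the equator, so orthogonality gives W
= 0; thus AW vanishes identically. Since (x² + y²)P_n = xA and (x² + y²)Q_n = yA, the polynomial A
is nonzero, so W = 0. A zero of A would then be an equilibrium on the equator, which is excluded. -/

/-! ### Coordinates and unit vectors in the plane -/

lemma hasDerivWithinAt_euclidean {ι : Type*} [Fintype ι] {f : ℝ → EuclideanSpace ℝ ι}
    {f' : EuclideanSpace ℝ ι} {s : Set ℝ} {t : ℝ} :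
    HasDerivWithinAt f f' s t ↔ ∀ i, HasDerivWithinAt (fun x => f x i) (f' i) s t := by
  simp only [hasDerivWithinAt_iff_hasFDerivWithinAt]
  rw [hasFDerivWithinAt_euclidean]
  refine forall_congr' fun i => ?_
  have : (PiLp.proj 2 (fun _ : ι => ℝ) i : EuclideanSpace ℝ ι →L[ℝ] ℝ) ∘L
      ContinuousLinearMap.toSpanSingleton ℝ f' = ContinuousLinearMap.toSpanSingleton ℝ (f' i) := by
    ext; simp
  rw [← this]

lemma hasDerivAt_euclidean {ι : Type*} [Fintype ι] {f : ℝ → EuclideanSpace ℝ ι}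
    {f' : EuclideanSpace ℝ ι} {t : ℝ} :
    HasDerivAt f f' t ↔ ∀ i, HasDerivAt (fun x => f x i) (f' i) t := by
  simp only [← hasDerivWithinAt_univ]
  exact hasDerivWithinAt_euclidean

/-- Rotation of the plane by a right angle. -/
def quarterTurn (w : Plane) : Plane := !₂[-w 1, w 0]

@[simp] lemma quarterTurn_zero (w : Plane) : quarterTurn w 0 = -w 1 := rfl

@[simp] lemma quarterTurn_one (w : Plane) : quarterTurn w 1 = w 0 := rfl

lemma inner_plane (v w : Plane) : inner ℝ v w = v 0 * w 0 + v 1 * w 1 := by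
  simp [PiLp.inner_apply, Fin.sum_univ_two, mul_comm]

lemma norm_sq_plane (w : Plane) : ‖w‖ ^ 2 = w 0 ^ 2 + w 1 ^ 2 := by
  simp [EuclideanSpace.norm_sq_eq, Fin.sum_univ_two]

lemma sum_sq_eq_one {w : Plane} (hw : ‖w‖ = 1) : w 0 ^ 2 + w 1 ^ 2 = 1 := by
  rw [← norm_sq_plane, hw, one_pow]

lemma inner_quarterTurn (w : Plane) : inner ℝ w (quarterTurn w) = 0 := by
  rw [inner_plane]; simp; ring

lemma contDiff_coord (i : Fin 2) : ContDiff ℝ 1 (fun w : Plane => w i) := by fun_prop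

lemma contDiff_quarterTurn : ContDiff ℝ 1 quarterTurn := by
  rw [contDiff_euclidean]
  intro i
  fin_cases i
  · exact (contDiff_coord 1).neg
  · exact contDiff_coord 0

/-- The unit vector with polar angle `θ`. -/
noncomputable def unitVector (θ : ℝ) : Plane := !₂[Real.cos θ, Real.sin θ]

lemma norm_unitVector (θ : ℝ) : ‖unitVector θ‖ = 1 := by
  have h : ‖unitVector θ‖ ^ 2 = 1 := by
    rw [norm_sq_plane]; simp [unitVector]
  nlinarith [norm_nonneg (unitVector θ)]

lemma hasDerivAt_unitVector (θ : ℝ) :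
    HasDerivAt unitVector (quarterTurn (unitVector θ)) θ := by
  rw [hasDerivAt_euclidean]
  intro i
  fin_cases i
  · simpa [unitVector] using Real.hasDerivAt_cos θ
  · simpa [unitVector] using Real.hasDerivAt_sin θ

lemma contDiff_unitVector : ContDiff ℝ 1 unitVector := by
  rw [contDiff_euclidean]
  intro i
  fin_cases i
  · exact Real.contDiff_cos
  · exact Real.contDiff_sin

/-- The bounded range of angles, [-π, π] ⊆ [-4, 4], supplies the compactness behind an existence
interval uniform in the initial direction. -/
lemma exists_unitVector_eq {w : Plane} (hw : ‖w‖ = 1) :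
    ∃ θ ∈ Icc (-4 : ℝ) 4, unitVector θ = w := by
  set z : ℂ := ⟨w 0, w 1⟩ with hz
  have hn : ‖z‖ = 1 := by
    have h : ‖z‖ ^ 2 = 1 := by
      rw [← Complex.normSq_eq_norm_sq, Complex.normSq_mk]
      linarith [sum_sq_eq_one hw]
    nlinarith [norm_nonneg z]
  have hz0 : z ≠ 0 := by
    intro h; simp [h] at hn
  refine ⟨Complex.arg z, ⟨?_, ?_⟩, ?_⟩
  · linarith [Complex.neg_pi_lt_arg z, Real.pi_lt_four]
  · linarith [Complex.arg_le_pi z, Real.pi_lt_four]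
  · ext i
    fin_cases i
    · change Real.cos z.arg = w 0
      rw [Complex.cos_arg hz0, hn, div_one]
    · change Real.sin z.arg = w 1
      rw [Complex.sin_arg, hn, div_one]

/-! ### Existence for scalar differential equations -/

/-- A scalar autonomous equation with positive, bounded, continuous right-hand side has a global
solution, which increases to infinity. -/
lemma exists_global_solution_of_pos_of_le {k : ℝ → ℝ} (hk : Continuous k) (hpos : ∀ x, 0 < k x)
    {C : ℝ} (hC : ∀ x, k x ≤ C) (y₀ : ℝ) :
    ∃ y : ℝ → ℝ, y 0 = y₀ ∧ (∀ t, HasDerivAt y (k (y t)) t) ∧ StrictMono y ∧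
      Tendsto y atTop atTop := by
  have hC0 : 0 < C := (hpos 0).trans_le (hC 0)
  -- S y is the time needed to travel from y₀ to y; the solution is its inverse.
  set S : ℝ → ℝ := fun y => ∫ x in y₀..y, (k x)⁻¹ with hS
  have hcont : Continuous fun x => (k x)⁻¹ := hk.inv₀ fun x => (hpos x).ne'
  have hderiv : ∀ y, HasDerivAt S (k y)⁻¹ y := fun y =>
    (hcont.integral_hasStrictDerivAt y₀ y).hasDerivAt
  have hSc : Continuous S := continuous_iff_continuousAt.2 fun y => (hderiv y).continuousAt
  have hmono : StrictMono S := strictMono_of_deriv_pos fun y => by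
    rw [(hderiv y).deriv]; exact inv_pos.2 (hpos y)
  have hS0 : S y₀ = 0 := by simp [hS]
  -- The bound 1 / k ≥ 1 / C makes S grow at least linearly, so S is onto ℝ and the solution is
  -- global.
  have hmono' : Monotone fun y => S y - C⁻¹ * y := by
    have hd : ∀ y, HasDerivAt (fun y => S y - C⁻¹ * y) ((k y)⁻¹ - C⁻¹) y := fun y => by
      simpa using (hderiv y).fun_sub ((hasDerivAt_id' y).const_mul C⁻¹)
    refine monotone_of_deriv_nonneg (fun y => (hd y).differentiableAt) fun y => ?_
    rw [(hd y).deriv]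
    exact sub_nonneg.2 (inv_anti₀ (hpos y) (hC y))
  have htop : Tendsto S atTop atTop := by
    have h1 : Tendsto (fun y => C⁻¹ * y + (S y₀ - C⁻¹ * y₀)) atTop atTop :=
      tendsto_atTop_add_const_right _ _ (tendsto_id.const_mul_atTop (inv_pos.2 hC0))
    refine tendsto_atTop_mono' _ ?_ h1
    filter_upwards [eventually_ge_atTop y₀] with y hy
    have := hmono' hy
    simp only at this
    linarith
  have hbot : Tendsto S atBot atBot := by
    have h1 : Tendsto (fun y => C⁻¹ * y + (S y₀ - C⁻¹ * y₀)) atBot atBot :=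
      tendsto_atBot_add_const_right _ _ (tendsto_id.const_mul_atBot (inv_pos.2 hC0))
    refine tendsto_atBot_mono' _ ?_ h1
    filter_upwards [eventually_le_atBot y₀] with y hy
    have := hmono' hy
    simp only at this
    linarith
  set e := hmono.orderIsoOfSurjective S (hSc.surjective htop hbot) with he
  have heS : ∀ y, e y = S y := fun y => rfl
  have hes : ∀ t, S (e.symm t) = t := fun t => by rw [← heS]; simp
  refine ⟨e.symm, ?_, fun t => ?_, e.symm.strictMono, e.symm.tendsto_atTop⟩
  · rw [← hS0, ← heS]; simp
  · have := HasDerivAt.of_local_left_inverse (g := e.symm) (a := t)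
      e.symm.continuous.continuousAt (hderiv (e.symm t)) (inv_pos.2 (hpos _)).ne'
      (Eventually.of_forall hes)
    simpa using this

/-- Local solutions of a scalar equation exist on an interval of uniform length, for initial values
in a compact set. -/
lemma exists_uniform_scalar_solution {h : ℝ × ℝ → ℝ} {δ : ℝ} (hδ : 0 < δ)
    (hh : ∀ p ∈ Icc (-δ) δ ×ˢ Icc (-5 : ℝ) 5, ContDiffAt ℝ 1 h p) :
    ∃ ε ∈ Ioc 0 δ, ∀ r₀ ∈ Ioo (-ε) ε, ∀ θ₀ ∈ Icc (-4 : ℝ) 4, ∃ Θ : ℝ → ℝ, Θ r₀ = θ₀ ∧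
      ∀ r ∈ Ioo (-ε) ε, HasDerivAt Θ (h (r, Θ r)) r := by
  have hcomp : IsCompact (Icc (-δ) δ ×ˢ Icc (-5 : ℝ) 5) := isCompact_Icc.prod isCompact_Icc
  have hcont : ContinuousOn h (Icc (-δ) δ ×ˢ Icc (-5 : ℝ) 5) := fun p hp =>
    (hh p hp).continuousAt.continuousWithinAt
  obtain ⟨M, hM⟩ := hcomp.exists_bound_of_continuousOn hcont
  have hlip : LocallyLipschitzOn (Icc (-δ) δ ×ˢ Icc (-5 : ℝ) 5) h := fun p hp => by
    obtain ⟨K, t, ht, hK⟩ := (hh p hp).exists_lipschitzOnWith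
    exact ⟨K, t, mem_nhdsWithin_of_mem_nhds ht, hK⟩
  obtain ⟨K, hK⟩ := hlip.exists_lipschitzOnWith_of_compact hcomp
  set L : ℝ := max M 0 + 1 with hL
  have hL1 : 1 ≤ L := by rw [hL]; linarith [le_max_right M 0]
  -- At speed at most L, a time 2ε moves the solution by at most 1, from [-4, 4] to within [-5, 5].
  -- The length 2ε covers the whole interval wherever r₀ lies in it.
  set ε : ℝ := min δ (1 / (2 * L)) with hε
  have hε0 : 0 < ε := lt_min hδ (by positivity)
  have hεδ : ε ≤ δ := min_le_left _ _
  have hεL : L * (2 * ε) ≤ 1 := by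
    have : ε ≤ 1 / (2 * L) := min_le_right _ _
    rw [le_div_iff₀ (by positivity)] at this
    linarith
  refine ⟨ε, ⟨hε0, hεδ⟩, fun r₀ hr₀ θ₀ hθ₀ => ?_⟩
  have hmem : ∀ t ∈ Icc (-ε) ε, ∀ x ∈ Metric.closedBall θ₀ 1,
      (t, x) ∈ Icc (-δ) δ ×ˢ Icc (-5 : ℝ) 5 := fun t ht x hx => by
    rw [Real.closedBall_eq_Icc] at hx
    exact ⟨⟨by linarith [ht.1], by linarith [ht.2]⟩,
      ⟨by linarith [hx.1, hθ₀.1], by linarith [hx.2, hθ₀.2]⟩⟩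
  have hPL : IsPicardLindelof (fun r θ => h (r, θ)) (tmin := -ε) (tmax := ε)
      ⟨r₀, Ioo_subset_Icc_self hr₀⟩ θ₀ 1 0 ⟨L, by linarith⟩ K := by
    refine ⟨fun t ht => ?_, fun x hx => ?_, fun t ht x hx => ?_, ?_⟩
    · refine LipschitzOnWith.of_dist_le_mul fun x hx y hy => ?_
      have := hK.dist_le_mul _ (hmem t ht x hx) _ (hmem t ht y hy)
      simpa [Prod.dist_eq] using this
    · exact hcont.comp (by fun_prop) fun t ht => hmem t ht x hx
    · refine (hM _ (hmem t ht x hx)).trans ?_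
      change M ≤ L
      linarith [le_max_left M 0]
    · change L * max (ε - r₀) (r₀ - -ε) ≤ 1 - 0
      have : max (ε - r₀) (r₀ - -ε) ≤ 2 * ε :=
        max_le (by linarith [hr₀.1]) (by linarith [hr₀.2])
      nlinarith
  obtain ⟨Θ, h0, hΘ⟩ := hPL.exists_eq_forall_mem_Icc_hasDerivWithinAt₀
  exact ⟨Θ, h0, fun r hr => (hΘ r (Ioo_subset_Icc_self hr)).hasDerivAt (Icc_mem_nhds hr.1 hr.2)⟩

/-! ### Leaves of the polar desingularization -/

/-- Integral curves of the desingularized field in polar coordinates, parametrized by the radius: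
they are transversal to the circle `r = 0`. -/
lemma exists_uniform_leaf {α β : ℝ → Plane → ℝ}
    (hα : ContDiff ℝ 1 fun p : ℝ × Plane => α p.1 p.2)
    (hβ : ContDiff ℝ 1 fun p : ℝ × Plane => β p.1 p.2)
    (hpos : ∀ ω : Plane, ‖ω‖ = 1 → 0 < α 0 ω) :
    ∃ δ > 0, (∀ r ∈ Ioo (-δ) δ, ∀ ω : Plane, ‖ω‖ = 1 → 0 < α r ω) ∧
      ∀ r₀ ∈ Ioo (-δ) δ, ∀ ω₀ : Plane, ‖ω₀‖ = 1 → ∃ Ω : ℝ → Plane, Ω r₀ = ω₀ ∧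
        ∀ r ∈ Ioo (-δ) δ, ‖Ω r‖ = 1 ∧
          HasDerivAt Ω (-(β r (Ω r) / α r (Ω r)) • quarterTurn (Ω r)) r := by
  have hev : ∀ᶠ r in 𝓝 (0 : ℝ), ∀ ω ∈ Metric.sphere (0 : Plane) 1, 0 < α r ω := by
    refine (isCompact_sphere (0 : Plane) 1).eventually_forall_of_forall_eventually fun ω hω => ?_
    exact hα.continuous.continuousAt.eventually (lt_mem_nhds (hpos ω (by simpa using hω)))
  obtain ⟨δ, hδ, hball⟩ := Metric.eventually_nhds_iff_ball.1 hev
  have hαpos : ∀ r ∈ Ioo (-δ) δ, ∀ ω : Plane, ‖ω‖ = 1 → 0 < α r ω := fun r hr ω hω =>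
    hball r (by simpa [abs_lt] using hr) ω (by simpa using hω)
  -- In terms of the polar angle the leaf equation is scalar. It is regular across r = 0, so leaves
  -- starting at any small radius reach the circle.
  set h : ℝ × ℝ → ℝ := fun p => -(β p.1 (unitVector p.2) / α p.1 (unitVector p.2)) with hh
  have hcd : ∀ p ∈ Icc (-(δ / 2)) (δ / 2) ×ˢ Icc (-5 : ℝ) 5, ContDiffAt ℝ 1 h p := by
    intro p hp
    have hm : ContDiff ℝ 1 fun p : ℝ × ℝ => (p.1, unitVector p.2) :=
      contDiff_fst.prodMk (contDiff_unitVector.comp contDiff_snd)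
    refine ((hβ.comp hm).contDiffAt.div (hα.comp hm).contDiffAt ?_).neg
    exact (hαpos p.1 ⟨by linarith [hp.1.1], by linarith [hp.1.2]⟩ _ (norm_unitVector _)).ne'
  obtain ⟨ε, hε, hsol⟩ := exists_uniform_scalar_solution (half_pos hδ) hcd
  have hsub : Ioo (-ε) ε ⊆ Ioo (-δ) δ := fun r hr =>
    ⟨by linarith [hr.1, hε.2], by linarith [hr.2, hε.2]⟩
  refine ⟨ε, hε.1, fun r hr => hαpos r (hsub hr), fun r₀ hr₀ ω₀ hω₀ => ?_⟩
  obtain ⟨θ₀, hθ₀, rfl⟩ := exists_unitVector_eq hω₀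
  obtain ⟨Θ, hΘ0, hΘ⟩ := hsol r₀ hr₀ θ₀ hθ₀
  refine ⟨fun r => unitVector (Θ r), by simp [hΘ0], fun r hr => ⟨norm_unitVector _, ?_⟩⟩
  exact (hasDerivAt_unitVector (Θ r)).scomp r (hΘ r hr)

/-- A leaf `r ↦ r • Ω r` carries a trajectory that enters the origin in the direction `Ω 0`. -/
lemma exists_enteringTrajectory_of_leaf {G : Plane → Plane} {d : ℕ} (hd : 1 ≤ d)
    {α β : ℝ → Plane → ℝ} (hα : ContDiff ℝ 1 fun p : ℝ × Plane => α p.1 p.2)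
    (hG : ∀ r > 0, ∀ ω : Plane, ‖ω‖ = 1 →
      G (r • ω) = r ^ d • (-α r ω • ω + (r * β r ω) • quarterTurn ω))
    {δ : ℝ} (hpos : ∀ r ∈ Ioo (-δ) δ, ∀ ω : Plane, ‖ω‖ = 1 → 0 < α r ω) {Ω : ℝ → Plane}
    (hΩ : ∀ r ∈ Ioo (-δ) δ, ‖Ω r‖ = 1 ∧
      HasDerivAt Ω (-(β r (Ω r) / α r (Ω r)) • quarterTurn (Ω r)) r)
    {r₀ : ℝ} (hr₀ : r₀ ∈ Ioo 0 δ) :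
    ∃ γ : ℝ → Plane, γ 0 = r₀ • Ω r₀ ∧ IsEnteringTrajectory G 0 γ ∧
      (∀ t ∈ Ici (0 : ℝ), ‖γ t‖ ≤ r₀) ∧ HasLimitDirection γ 0 (Ω 0) := by
  have hδ : 0 < δ := hr₀.1.trans hr₀.2
  have hIcc : Icc 0 r₀ ⊆ Ioo (-δ) δ := fun r hr => ⟨by linarith [hr.1], by linarith [hr.2, hr₀.2]⟩
  set y₀ : ℝ := -Real.log r₀ with hy₀
  have hexp : Real.exp (-y₀) = r₀ := by rw [hy₀, neg_neg, Real.exp_log hr₀.1]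
  -- With y = -log r the equation r' = -r^d α becomes y' = r^(d-1) α, bounded because d ≥ 1; so r
  -- tends to 0 only in infinite time. The maximum freezes r at r₀ for y < y₀, which extends the
  -- equation to the whole line.
  set R : ℝ → ℝ := fun y => Real.exp (-max y y₀) with hR
  have hRpos : ∀ y, 0 < R y := fun y => Real.exp_pos _
  have hRle : ∀ y, R y ≤ r₀ := fun y => by
    rw [← hexp]; exact Real.exp_le_exp.2 (neg_le_neg (le_max_right _ _))
  have hRmem : ∀ y, R y ∈ Icc 0 r₀ := fun y => ⟨(hRpos y).le, hRle y⟩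
  have hRc : Continuous R := by fun_prop
  have hΩc : ContinuousOn Ω (Icc 0 r₀) := fun r hr =>
    (hΩ r (hIcc hr)).2.continuousAt.continuousWithinAt
  set f : ℝ → ℝ := fun r => r ^ (d - 1) * α r (Ω r) with hf
  have hfc : ContinuousOn f (Icc 0 r₀) :=
    (continuous_pow _).continuousOn.mul
      (hα.continuous.comp_continuousOn (continuousOn_id.prodMk hΩc))
  obtain ⟨C, hC⟩ := isCompact_Icc.exists_bound_of_continuousOn hfc
  obtain ⟨y, hy0, hyd, hym, hyt⟩ := exists_global_solution_of_pos_of_le (k := fun y => f (R y))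
    (hfc.comp_continuous hRc hRmem)
    (fun y => mul_pos (pow_pos (hRpos y) _) (hpos _ (hIcc (hRmem y)) _ (hΩ _ (hIcc (hRmem y))).1))
    (fun y => (le_abs_self _).trans (hC _ (hRmem y))) y₀
  set ρ : ℝ → ℝ := fun t => Real.exp (-y t) with hρ
  have hρpos : ∀ t, 0 < ρ t := fun t => Real.exp_pos _
  have hρR : ∀ t ∈ Ici (0 : ℝ), R (y t) = ρ t := fun t ht => by
    have : y₀ ≤ y t := hy0 ▸ hym.monotone ht
    simp only [hR, hρ, max_eq_left this]
  have hρle : ∀ t ∈ Ici (0 : ℝ), ρ t ≤ r₀ := fun t ht => hρR t ht ▸ hRle _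
  have hρmem : ∀ t ∈ Ici (0 : ℝ), ρ t ∈ Ioo (-δ) δ := fun t ht =>
    hIcc ⟨(hρpos t).le, hρle t ht⟩
  have hρ0 : Tendsto ρ atTop (𝓝 0) := Real.tendsto_exp_neg_atTop_nhds_zero.comp hyt
  have hnorm : ∀ t ∈ Ici (0 : ℝ), ‖ρ t • Ω (ρ t)‖ = ρ t := fun t ht => by
    rw [norm_smul, (hΩ _ (hρmem t ht)).1, mul_one, Real.norm_of_nonneg (hρpos t).le]
  refine ⟨fun t => ρ t • Ω (ρ t), ?_, ⟨?_, ?_, ?_⟩, fun t ht => (hnorm t ht).trans_le (hρle t ht),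
    ?_⟩
  · simp only [hρ, hy0, hexp]
  · intro t ht
    obtain ⟨hΩ1, hΩd⟩ := hΩ _ (hρmem t ht)
    have hρd : HasDerivAt ρ (-(ρ t ^ d * α (ρ t) (Ω (ρ t)))) t := by
      refine HasDerivAt.congr_deriv (f' := Real.exp (-y t) * -f (R (y t))) (hyd t).neg.exp ?_
      rw [hρR t ht]
      obtain ⟨e, rfl⟩ := Nat.exists_eq_add_of_le' hd
      simp only [hf, Nat.add_sub_cancel, hρ]
      ring
    have h := hρd.smul (hΩd.scomp t hρd)
    refine HasDerivAt.hasDerivWithinAt (HasDerivAt.congr_deriv h ?_)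
    change _ = G (ρ t • Ω (ρ t))
    rw [hG _ (hρpos t) _ hΩ1]
    have hne := (hpos _ (hρmem t ht) _ hΩ1).ne'
    simp only [smul_add, smul_smul, Function.comp]
    rw [add_comm]
    congr 2
    · ring
    · field_simp
  · intro t ht h
    have := hnorm t ht
    rw [h, norm_zero] at this
    exact (hρpos t).ne this
  · rw [tendsto_zero_iff_norm_tendsto_zero]
    refine hρ0.congr' ?_
    filter_upwards [eventually_ge_atTop 0] with t ht
    exact (hnorm t ht).symm
  · have h0 : ContinuousAt Ω 0 := (hΩ 0 ⟨by linarith, hδ⟩).2.continuousAt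
    refine (h0.tendsto.comp hρ0).congr' ?_
    filter_upwards [eventually_ge_atTop 0] with t ht
    simp only [sub_zero, Function.comp]
    rw [hnorm t ht, smul_smul, inv_mul_cancel₀ (hρpos t).ne', one_smul]

/-- A trajectory that enters the origin in the direction `Ω 0` eventually runs along the leaf
`r ↦ r • Ω r`. -/
lemma IsEnteringTrajectory.eventually_eq_leaf {G : Plane → Plane} {d : ℕ}
    {α β : ℝ → Plane → ℝ} (hα : ContDiff ℝ 1 fun p : ℝ × Plane => α p.1 p.2)
    (hβ : ContDiff ℝ 1 fun p : ℝ × Plane => β p.1 p.2)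
    (hG : ∀ r > 0, ∀ ω : Plane, ‖ω‖ = 1 →
      G (r • ω) = r ^ d • (-α r ω • ω + (r * β r ω) • quarterTurn ω))
    {δ : ℝ} (hδ : 0 < δ) (hpos : ∀ r ∈ Ioo (-δ) δ, ∀ ω : Plane, ‖ω‖ = 1 → 0 < α r ω)
    {Ω : ℝ → Plane}
    (hΩ : ∀ r ∈ Ioo (-δ) δ, ‖Ω r‖ = 1 ∧
      HasDerivAt Ω (-(β r (Ω r) / α r (Ω r)) • quarterTurn (Ω r)) r)
    {γ : ℝ → Plane} (hγ : IsEnteringTrajectory G 0 γ) (hdir : HasLimitDirection γ 0 (Ω 0)) :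
    ∀ᶠ t in atTop, γ t = ‖γ t‖ • Ω ‖γ t‖ := by
  have hδ0 : (0 : ℝ) ∈ Ioo (-δ) δ := ⟨by linarith, hδ⟩
  set V : ℝ × Plane → Plane := fun p => -(β p.1 p.2 / α p.1 p.2) • quarterTurn p.2 with hV
  have hVc : ContDiffAt ℝ 1 V (0, Ω 0) :=
    (hβ.contDiffAt.div hα.contDiffAt (hpos 0 hδ0 _ (hΩ 0 hδ0).1).ne').neg.smul
      (contDiff_quarterTurn.comp contDiff_snd).contDiffAt
  obtain ⟨K, s, hs, hK⟩ := hVc.exists_lipschitzOnWith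
  set r : ℝ → ℝ := fun t => ‖γ t‖ with hr
  set ω : ℝ → Plane := fun t => (r t)⁻¹ • γ t with hω
  have hr0 : Tendsto r atTop (𝓝 0) := by simpa using hγ.tendsto.norm
  have hωe : Tendsto ω atTop (𝓝 (Ω 0)) := by
    simpa [HasLimitDirection, hω, hr] using hdir
  have hΩr : Tendsto (fun t => Ω (r t)) atTop (𝓝 (Ω 0)) :=
    (hΩ 0 hδ0).2.continuousAt.tendsto.comp hr0
  have hev : ∀ᶠ t in atTop, r t < δ ∧ (r t, ω t) ∈ s ∧ (r t, Ω (r t)) ∈ s :=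
    (hr0.eventually (gt_mem_nhds hδ)).and
      (((hr0.prodMk_nhds hωe).eventually hs).and ((hr0.prodMk_nhds hΩr).eventually hs))
  obtain ⟨T, hT⟩ := eventually_atTop.1 (hev.and (eventually_gt_atTop 0))
  have hrpos : ∀ t ≥ T, 0 < r t := fun t ht => norm_pos_iff.2 (hγ.ne t (hT t ht).2.le)
  have hrmem : ∀ t ≥ T, r t ∈ Ioo (-δ) δ := fun t ht =>
    ⟨by linarith [hrpos t ht], (hT t ht).1.1⟩
  have hω1 : ∀ t ≥ T, ‖ω t‖ = 1 := fun t ht => by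
    simp only [hω, norm_smul, norm_inv, hr, norm_norm]
    exact inv_mul_cancel₀ (hrpos t ht).ne'
  have hγω : ∀ t ≥ T, γ t = r t • ω t := fun t ht => by
    simp only [hω, smul_smul, mul_inv_cancel₀ (hrpos t ht).ne', one_smul]
  set r' : ℝ → ℝ := fun t => -(r t ^ d * α (r t) (ω t)) with hr'
  have hr'neg : ∀ t ≥ T, r' t ≤ 0 := fun t ht =>
    neg_nonpos.2 (mul_pos (pow_pos (hrpos t ht) _) (hpos _ (hrmem t ht) _ (hω1 t ht))).le
  have hγd : ∀ t ≥ T, HasDerivAt γ (G (γ t)) t := fun t ht =>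
    (hγ.solution t (hT t ht).2.le).hasDerivAt (Ici_mem_nhds (hT t ht).2)
  have hrd : ∀ t ≥ T, HasDerivAt r (r' t) t := fun t ht => by
    have h1 := ((hγd t ht).norm_sq).sqrt (pow_pos (hrpos t ht) 2).ne'
    have h2 : (fun t => Real.sqrt (‖γ t‖ ^ 2)) = r := by
      funext u; exact Real.sqrt_sq (norm_nonneg _)
    rw [h2, Real.sqrt_sq (norm_nonneg _)] at h1
    convert h1 using 1
    have h3 : inner ℝ (γ t) (G (γ t)) = -(r t ^ (d + 1) * α (r t) (ω t)) := by
      rw [hγω t ht, hG _ (hrpos t ht) _ (hω1 t ht)]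
      simp only [inner_smul_left, inner_smul_right, inner_add_right, inner_quarterTurn,
        real_inner_self_eq_norm_sq, hω1 t ht]
      simp
      ring
    rw [h3]
    have := (hrpos t ht).ne'
    simp only [hr']
    change _ = 2 * -(r t ^ (d + 1) * α (r t) (ω t)) / (2 * r t)
    field_simp
    ring
  have hωd : ∀ t ≥ T, HasDerivAt ω (r' t • V (r t, ω t)) t := fun t ht => by
    have h1 := ((hrd t ht).fun_inv (hrpos t ht).ne').smul (hγd t ht)
    refine HasDerivAt.congr_deriv h1 ?_
    have h2 : G (γ t) = r t ^ d • (-α (r t) (ω t) • ω t +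
        (r t * β (r t) (ω t)) • quarterTurn (ω t)) := by
      rw [← hG _ (hrpos t ht) _ (hω1 t ht), ← hγω t ht]
    rw [h2]
    conv_lhs => rw [hγω t ht]
    have h3 := (hrpos t ht).ne'
    have h4 := (hpos _ (hrmem t ht) _ (hω1 t ht)).ne'
    ext i
    simp only [hV, hr', PiLp.add_apply, PiLp.smul_apply, smul_eq_mul]
    field_simp
    ring
  set D : ℝ → Plane := fun t => ω t - Ω (r t) with hD
  have hDd : ∀ t ≥ T, HasDerivAt D (r' t • (V (r t, ω t) - V (r t, Ω (r t)))) t := fun t ht => by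
    rw [smul_sub]
    exact (hωd t ht).sub ((hΩ _ (hrmem t ht)).2.scomp t (hrd t ht))
  -- Backward Gronwall argument: the radius serves as the time variable and decreases to 0. Since r'
  -- ≤ 0 and V is K-Lipschitz in ω, this weighted square distance is nondecreasing; being
  -- nonnegative with limit 0, it vanishes.
  set E : ℝ → ℝ := fun t => ‖D t‖ ^ 2 * Real.exp (-(2 * K) * r t) with hE
  have hEd : ∀ t ≥ T, HasDerivAt E
      (2 * inner ℝ (D t) (r' t • (V (r t, ω t) - V (r t, Ω (r t)))) * Real.exp (-(2 * K) * r t) +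
        ‖D t‖ ^ 2 * (Real.exp (-(2 * K) * r t) * (-(2 * K) * r' t))) t := fun t ht =>
    ((hDd t ht).norm_sq).mul ((hrd t ht).const_mul _).exp
  have hmono : MonotoneOn E (Ici T) := by
    refine monotoneOn_of_deriv_nonneg (convex_Ici T)
      (fun t ht => (hEd t ht).continuousAt.continuousWithinAt)
      (fun t ht => (hEd t (interior_subset ht)).differentiableAt.differentiableWithinAt)
      fun t ht => ?_
    replace ht : t ≥ T := interior_subset ht
    rw [(hEd t ht).deriv]
    have hlip : ‖V (r t, ω t) - V (r t, Ω (r t))‖ ≤ K * ‖D t‖ := by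
      have := hK.dist_le_mul _ (hT t ht).1.2.1 _ (hT t ht).1.2.2
      rwa [Prod.dist_eq, dist_self, max_eq_right dist_nonneg, dist_eq_norm, dist_eq_norm] at this
    have hin : inner ℝ (D t) (V (r t, ω t) - V (r t, Ω (r t))) ≤ K * ‖D t‖ ^ 2 :=
      (real_inner_le_norm _ _).trans (by nlinarith [norm_nonneg (D t)])
    rw [inner_smul_right]
    have := mul_nonneg_of_nonpos_of_nonpos (hr'neg t ht) (sub_nonpos.2 hin)
    have := mul_nonneg this (Real.exp_pos (-(2 * K) * r t)).le
    linarith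
  have hD0 : Tendsto D atTop (𝓝 0) := by simpa using hωe.sub hΩr
  have hE0 : Tendsto E atTop (𝓝 0) := by
    have := (hD0.norm.pow 2).mul (hr0.const_mul (-(2 * (K : ℝ)))).rexp
    rwa [norm_zero, zero_pow two_ne_zero, zero_mul] at this
  filter_upwards [eventually_ge_atTop T] with t ht
  have hEle : E t ≤ 0 := ge_of_tendsto hE0 (by
    filter_upwards [eventually_ge_atTop t] with u hu
    exact hmono ht (le_trans ht hu) hu)
  have hDz : ‖D t‖ ^ 2 ≤ 0 := nonpos_of_mul_nonpos_left hEle (Real.exp_pos _)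
  have : ω t = Ω (r t) := by
    rw [← sub_eq_zero, ← norm_eq_zero]
    exact pow_eq_zero_iff two_ne_zero |>.1 (le_antisymm hDz (by positivity))
  change γ t = r t • Ω (r t)
  rw [← this]
  exact hγω t ht

/-! ### Uniqueness of trajectories and the criterion for a dicritical node -/

/-- Forward uniqueness for integral curves of a `C¹` vector field. -/
lemma IsIntegralCurveOn.eq_of_eq_zero {E : Type*} [NormedAddCommGroup E] [NormedSpace ℝ E]
    {G : E → E} (hG : ContDiff ℝ 1 G) {γ₁ γ₂ : ℝ → E}
    (h₁ : IsIntegralCurveOn γ₁ (fun _ => G) (Ici 0))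
    (h₂ : IsIntegralCurveOn γ₂ (fun _ => G) (Ici 0)) (h : γ₁ 0 = γ₂ 0) :
    ∀ t ≥ (0 : ℝ), γ₁ t = γ₂ t := by
  intro t ht
  have hc₁ : ContinuousOn γ₁ (Icc 0 t) := h₁.continuousOn.mono Icc_subset_Ici_self
  have hc₂ : ContinuousOn γ₂ (Icc 0 t) := h₂.continuousOn.mono Icc_subset_Ici_self
  have hcomp : IsCompact (γ₁ '' Icc 0 t ∪ γ₂ '' Icc 0 t) :=
    (isCompact_Icc.image_of_continuousOn hc₁).union (isCompact_Icc.image_of_continuousOn hc₂)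
  obtain ⟨K, hK⟩ := (hG.locallyLipschitz.locallyLipschitzOn
    (s := γ₁ '' Icc 0 t ∪ γ₂ '' Icc 0 t)).exists_lipschitzOnWith_of_compact hcomp
  exact ODE_solution_unique_of_mem_Icc_right (v := fun _ => G) (s := fun _ => _)
    (fun _ _ => hK) hc₁
    (fun u hu => (h₁ u hu.1).mono (Ici_subset_Ici.2 hu.1))
    (fun u hu => Or.inl (mem_image_of_mem _ (Ico_subset_Icc_self hu))) hc₂
    (fun u hu => (h₂ u hu.1).mono (Ici_subset_Ici.2 hu.1))
    (fun u hu => Or.inr (mem_image_of_mem _ (Ico_subset_Icc_self hu))) h ⟨ht, le_rfl⟩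

lemma IsIntegralCurveOn.shift {E : Type*} [NormedAddCommGroup E] [NormedSpace ℝ E]
    {G : E → E} {γ : ℝ → E} (h : IsIntegralCurveOn γ (fun _ => G) (Ici 0)) {a : ℝ} (ha : 0 ≤ a) :
    IsIntegralCurveOn (fun t => γ (a + t)) (fun _ => G) (Ici 0) := by
  intro t ht
  have ht : 0 ≤ t := ht
  have h1 : HasDerivWithinAt (fun t => a + t) 1 (Ici 0) t :=
    ((hasDerivAt_id' t).const_add a).hasDerivWithinAt
  have h2 := (h (a + t) (add_nonneg ha ht)).scomp t h1
    (fun u (hu : 0 ≤ u) => add_nonneg ha hu)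
  rw [one_smul] at h2
  exact h2

/-- A vector field whose polar desingularization is transversal to the circle `r = 0`, and points
inward, has a stable dicritical node at the origin. -/
theorem isStableDicriticalNode_of_polar_form {G : Plane → Plane} (hGc : ContDiff ℝ 1 G) {d : ℕ}
    (hd : 1 ≤ d) {α β : ℝ → Plane → ℝ} (hα : ContDiff ℝ 1 fun p : ℝ × Plane => α p.1 p.2)
    (hβ : ContDiff ℝ 1 fun p : ℝ × Plane => β p.1 p.2)
    (hpos₀ : ∀ ω : Plane, ‖ω‖ = 1 → 0 < α 0 ω)
    (hG : ∀ r > 0, ∀ ω : Plane, ‖ω‖ = 1 →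
      G (r • ω) = r ^ d • (-α r ω • ω + (r * β r ω) • quarterTurn ω)) :
    IsStableDicriticalNode G 0 := by
  obtain ⟨δ, hδ, hpos, hleaf⟩ := exists_uniform_leaf hα hβ hpos₀
  refine ⟨?_, fun N hN => ?_, fun e he => ?_, fun e γ₁ γ₂ h₁ hd₁ h₂ hd₂ => ?_⟩
  -- Continuity along one ray suffices: the polar form tends to 0 because d ≥ 1.
  · set ω : Plane := unitVector 0
    have hω : ‖ω‖ = 1 := norm_unitVector 0
    have h1 : Tendsto (fun r : ℝ => G (r • ω)) (𝓝[>] 0) (𝓝 (G 0)) := by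
      have : Continuous fun r : ℝ => G (r • ω) := hGc.continuous.comp (by fun_prop)
      simpa using (this.tendsto 0).mono_left nhdsWithin_le_nhds
    have h2 : Tendsto (fun r : ℝ => r ^ d • (-α r ω • ω + (r * β r ω) • quarterTurn ω))
        (𝓝[>] 0) (𝓝 0) := by
      have h3 : Continuous fun r : ℝ => α r ω :=
        hα.continuous.comp (continuous_id.prodMk continuous_const)
      have h4 : Continuous fun r : ℝ => β r ω :=
        hβ.continuous.comp (continuous_id.prodMk continuous_const)
      have : Continuous fun r : ℝ => r ^ d • (-α r ω • ω + (r * β r ω) • quarterTurn ω) := by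
        fun_prop
      have h5 := (this.tendsto 0).mono_left (nhdsWithin_le_nhds (s := Ioi 0))
      simpa [zero_pow (Nat.one_le_iff_ne_zero.1 hd)] using h5
    refine tendsto_nhds_unique h1 (h2.congr' ?_)
    filter_upwards [self_mem_nhdsWithin] with r hr
    exact (hG r hr ω hω).symm
  · obtain ⟨ε, hε, hball⟩ := Metric.mem_nhds_iff.1 hN
    refine ⟨Metric.ball 0 (min ε δ), Metric.ball_mem_nhds _ (lt_min hε hδ), fun q hq hq0 => ?_⟩
    rw [mem_ball_zero_iff, lt_min_iff] at hq
    have hqpos : 0 < ‖q‖ := norm_pos_iff.2 hq0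
    have hω : ‖‖q‖⁻¹ • q‖ = 1 := by
      rw [norm_smul, norm_inv, norm_norm, inv_mul_cancel₀ hqpos.ne']
    obtain ⟨Ω, hΩ0, hΩ⟩ := hleaf ‖q‖ ⟨by linarith, hq.2⟩ _ hω
    obtain ⟨γ, hγ0, hγ, hγle, hγdir⟩ :=
      exists_enteringTrajectory_of_leaf hd hα hG hpos hΩ ⟨hqpos, hq.2⟩
    refine ⟨γ, ?_, hγ, fun t ht => hball ?_, Ω 0, (hΩ 0 ⟨by linarith, hδ⟩).1, hγdir⟩
    · rw [hγ0, hΩ0, smul_smul, mul_inv_cancel₀ hqpos.ne', one_smul]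
    · rw [mem_ball_zero_iff]
      exact (hγle t ht).trans_lt hq.1
  · obtain ⟨Ω, hΩ0, hΩ⟩ := hleaf 0 ⟨by linarith, hδ⟩ e he
    obtain ⟨γ, -, hγ, -, hγdir⟩ := exists_enteringTrajectory_of_leaf hd hα hG hpos hΩ
      (r₀ := δ / 2) ⟨by linarith, by linarith⟩
    exact ⟨γ, hγ, hΩ0 ▸ hγdir⟩
  · have he : ‖e‖ = 1 := by
      refine tendsto_nhds_unique hd₁.norm (tendsto_const_nhds.congr' ?_)
      filter_upwards [eventually_ge_atTop 0] with t ht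
      rw [sub_zero, norm_smul, norm_inv, norm_norm,
        inv_mul_cancel₀ (norm_ne_zero_iff.2 (h₁.ne t ht))]
    obtain ⟨Ω, rfl, hΩ⟩ := hleaf 0 ⟨by linarith, hδ⟩ e he
    obtain ⟨T₁, hT₁⟩ := eventually_atTop.1
      (h₁.eventually_eq_leaf hα hβ hG hδ hpos hΩ hd₁)
    obtain ⟨T₂, hT₂⟩ := eventually_atTop.1
      (h₂.eventually_eq_leaf hα hβ hG hδ hpos hΩ hd₂)
    -- Both curves eventually follow the same leaf, where the radius determines the point. Times of
    -- equal radius come from the intermediate value theorem: ‖γ₁ a‖ is placed between ‖γ₂ c‖ and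
    -- ‖γ₂ b₀‖. Forward uniqueness then identifies the curves.
    set b₀ := max T₂ 0
    have hb₀ : 0 ≤ b₀ := le_max_right _ _
    have hn₁ : Tendsto (fun t => ‖γ₁ t‖) atTop (𝓝 0) := by simpa using h₁.tendsto.norm
    have hn₂ : Tendsto (fun t => ‖γ₂ t‖) atTop (𝓝 0) := by simpa using h₂.tendsto.norm
    obtain ⟨a, haT, ha0, ha⟩ := ((eventually_ge_atTop T₁).and ((eventually_ge_atTop 0).and
      (hn₁.eventually (gt_mem_nhds (norm_pos_iff.2 (h₂.ne b₀ hb₀)))))).exists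
    obtain ⟨c, hcb, hc⟩ := ((eventually_ge_atTop b₀).and
      (hn₂.eventually (gt_mem_nhds (norm_pos_iff.2 (h₁.ne a ha0))))).exists
    have hcont : ContinuousOn (fun t => ‖γ₂ t‖) (Icc b₀ c) :=
      (h₂.solution.continuousOn.mono fun t ht => hb₀.trans ht.1).norm
    obtain ⟨b, hb, hbeq⟩ := intermediate_value_Icc' hcb hcont ⟨hc.le, ha.le⟩
    simp only at hbeq
    have hb0 : 0 ≤ b := hb₀.trans hb.1
    refine ⟨a, ha0, b, hb0, ?_⟩
    refine (h₁.solution.shift ha0).eq_of_eq_zero hGc (h₂.solution.shift hb0) ?_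
    simp only [add_zero]
    rw [hT₁ a haT, hT₂ b ((le_max_left _ _).trans hb.1), hbeq]

/-! ### Homogenization and its radial and angular parts -/

open MvPolynomial in
lemma MvPolynomial.IsHomogeneous.eval_smul {σ R : Type*} [Fintype σ] [CommSemiring R]
    {p : MvPolynomial σ R} {k : ℕ} (hp : p.IsHomogeneous k) (c : R) (x : σ → R) :
    eval (c • x) p = c ^ k * eval x p := by
  rw [eval_eq', eval_eq', Finset.mul_sum]
  refine Finset.sum_congr rfl fun d hd => ?_
  have h : ∑ i, d i = k := by
    have := hp (mem_support_iff.1 hd)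
    simpa [Finsupp.weight_apply, Finsupp.sum_fintype] using this
  simp only [Pi.smul_apply, smul_eq_mul, mul_pow, Finset.prod_mul_distrib, Finset.prod_pow_eq_pow_sum,
    h]
  ring

lemma MvPolynomial.contDiff_eval {σ : Type*} [Fintype σ] (p : MvPolynomial σ ℝ) :
    ContDiff ℝ 1 fun x : σ → ℝ => MvPolynomial.eval x p :=
  (AnalyticOnNhd.eval_mvPolynomial p).contDiff

lemma contDiff_eval_plane (p : MvPolynomial (Fin 2) ℝ) :
    ContDiff ℝ 1 fun w : Plane => MvPolynomial.eval (fun i => w i) p :=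
  p.contDiff_eval.comp (by fun_prop : ContDiff ℝ 1 fun w : Plane => (fun i => w i : Fin 2 → ℝ))

lemma contDiff_planeField (P Q : MvPolynomial (Fin 2) ℝ) : ContDiff ℝ 1 (planeField P Q) := by
  rw [contDiff_euclidean]
  intro i
  fin_cases i
  · exact contDiff_eval_plane P
  · exact contDiff_eval_plane Q

open MvPolynomial in
/-- The value at `(c, w)` of the homogenization (in degree `n`) of the polynomial `p`. -/
noncomputable def homogenizedEval (n : ℕ) (p : MvPolynomial (Fin 2) ℝ) (c : ℝ) (w : Plane) : ℝ :=
  ∑ k ∈ Finset.range (n + 1), c ^ (n - k) * eval (fun i => w i) (homogeneousComponent k p)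

/-- The radial component `x p + y q` of the homogenization of the system `(p, q)`. -/
noncomputable def radialPart (n : ℕ) (P Q : MvPolynomial (Fin 2) ℝ) (c : ℝ) (w : Plane) : ℝ :=
  w 0 * homogenizedEval n P c w + w 1 * homogenizedEval n Q c w

open MvPolynomial in
/-- The angular component `x q - y p` of the homogenization of a projectively singular system
`(p, q)`, divided by the homogenizing variable. -/
noncomputable def angularPart (n : ℕ) (P Q : MvPolynomial (Fin 2) ℝ) (c : ℝ) (w : Plane) : ℝ :=
  ∑ k ∈ Finset.range n, c ^ (n - 1 - k) *
    eval (fun i => w i) (X 0 * homogeneousComponent k Q - X 1 * homogeneousComponent k P)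

lemma eval_sum_homogeneousComponent {n : ℕ} {p : MvPolynomial (Fin 2) ℝ} (hp : p.totalDegree ≤ n)
    (x : Fin 2 → ℝ) : MvPolynomial.eval x p =
      ∑ k ∈ Finset.range (n + 1), MvPolynomial.eval x (MvPolynomial.homogeneousComponent k p) := by
  conv_lhs => rw [← MvPolynomial.sum_homogeneousComponent p]
  rw [map_sum]
  refine Finset.sum_subset (Finset.range_mono (Nat.succ_le_succ hp)) fun k _ hk => ?_
  rw [MvPolynomial.homogeneousComponent_eq_zero _ _ (by simpa using hk), map_zero]

/-- Multiplication by `c ^ n` clears the denominators and leaves a polynomial in `c`, which still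
makes sense at infinity, `c = 0`. -/
lemma pow_mul_eval_inv_smul {n : ℕ} {p : MvPolynomial (Fin 2) ℝ} (hp : p.totalDegree ≤ n)
    {c : ℝ} (hc : c ≠ 0) (w : Plane) :
    c ^ n * MvPolynomial.eval (fun i => (c⁻¹ • w) i) p = homogenizedEval n p c w := by
  rw [eval_sum_homogeneousComponent hp, Finset.mul_sum]
  refine Finset.sum_congr rfl fun k hk => ?_
  have h1 : (fun i => (c⁻¹ • w) i) = c⁻¹ • (fun i => w i) := rfl
  rw [h1, (MvPolynomial.homogeneousComponent_isHomogeneous k p).eval_smul, ← mul_assoc,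
    pow_sub₀ c hc (Nat.lt_succ_iff.1 (Finset.mem_range.1 hk)), inv_pow]

lemma homogenizedEval_zero (n : ℕ) (p : MvPolynomial (Fin 2) ℝ) (w : Plane) :
    homogenizedEval n p 0 w =
      MvPolynomial.eval (fun i => w i) (MvPolynomial.homogeneousComponent n p) := by
  rw [homogenizedEval, Finset.sum_range_succ, Finset.sum_eq_zero]
  · simp
  · intro k hk
    rw [zero_pow (Nat.sub_ne_zero_of_lt (Finset.mem_range.1 hk)), zero_mul]

open MvPolynomial in
lemma radialPart_zero (n : ℕ) (P Q : MvPolynomial (Fin 2) ℝ) (w : Plane) :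
    radialPart n P Q 0 w =
      eval (fun i => w i) (X 0 * homogeneousComponent n P + X 1 * homogeneousComponent n Q) := by
  simp [radialPart, homogenizedEval_zero]

open MvPolynomial in
lemma angularPart_zero (n : ℕ) (P Q : MvPolynomial (Fin 2) ℝ) (w : Plane) :
    angularPart (n + 1) P Q 0 w =
      eval (fun i => w i) (X 0 * homogeneousComponent n Q - X 1 * homogeneousComponent n P) := by
  rw [angularPart, Finset.sum_range_succ, Finset.sum_eq_zero]
  · simp
  · intro k hk
    rw [Nat.add_sub_cancel, zero_pow (Nat.sub_ne_zero_of_lt (Finset.mem_range.1 hk)), zero_mul]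

/-- Projective singularity kills the term k = n, the only one without a factor `c`. -/
lemma IsProjectivelySingular.angular_eq {n : ℕ} {P Q : MvPolynomial (Fin 2) ℝ}
    (h : IsProjectivelySingular n P Q) (c : ℝ) (w : Plane) :
    w 0 * homogenizedEval n Q c w - w 1 * homogenizedEval n P c w = c * angularPart n P Q c w := by
  rw [homogenizedEval, homogenizedEval, angularPart, Finset.mul_sum, Finset.mul_sum,
    ← Finset.sum_sub_distrib, Finset.sum_range_succ, Finset.mul_sum]
  have htop : w 0 * (c ^ (n - n) * MvPolynomial.eval (fun i => w i)
      (MvPolynomial.homogeneousComponent n Q)) - w 1 * (c ^ (n - n) *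
      MvPolynomial.eval (fun i => w i) (MvPolynomial.homogeneousComponent n P)) = 0 := by
    have := congrArg (MvPolynomial.eval (fun i => w i)) h
    simpa using this
  rw [htop, add_zero]
  refine Finset.sum_congr rfl fun k hk => ?_
  have hk : n - k = n - 1 - k + 1 := by have := Finset.mem_range.1 hk; omega
  simp only [hk, pow_succ, map_sub, map_mul, MvPolynomial.eval_X]
  ring

lemma contDiff_homogenizedEval (n : ℕ) (p : MvPolynomial (Fin 2) ℝ) :
    ContDiff ℝ 1 fun q : ℝ × Plane => homogenizedEval n p q.1 q.2 :=
  ContDiff.sum fun _ _ => (contDiff_fst.pow _).mul ((contDiff_eval_plane _).comp contDiff_snd)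

lemma contDiff_radialPart (n : ℕ) (P Q : MvPolynomial (Fin 2) ℝ) :
    ContDiff ℝ 1 fun q : ℝ × Plane => radialPart n P Q q.1 q.2 :=
  (((contDiff_coord 0).comp contDiff_snd).mul (contDiff_homogenizedEval n P)).add
    (((contDiff_coord 1).comp contDiff_snd).mul (contDiff_homogenizedEval n Q))

lemma contDiff_angularPart (n : ℕ) (P Q : MvPolynomial (Fin 2) ℝ) :
    ContDiff ℝ 1 fun q : ℝ × Plane => angularPart n P Q q.1 q.2 :=
  ContDiff.sum fun _ _ => (contDiff_fst.pow _).mul ((contDiff_eval_plane _).comp contDiff_snd)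

open MvPolynomial in
lemma isHomogeneous_radial (n : ℕ) (P Q : MvPolynomial (Fin 2) ℝ) :
    (X 0 * homogeneousComponent n P + X 1 * homogeneousComponent n Q :
      MvPolynomial (Fin 2) ℝ).IsHomogeneous (n + 1) := by
  rw [add_comm n 1]
  exact ((isHomogeneous_X _ _).mul (homogeneousComponent_isHomogeneous _ _)).add
    ((isHomogeneous_X _ _).mul (homogeneousComponent_isHomogeneous _ _))

/-! ### The conjugate system in polar coordinates -/

/-- The radial component of the conjugate field in polar coordinates, up to a power of the
radius. -/
noncomputable def radialCoeff (n : ℕ) (P Q : MvPolynomial (Fin 2) ℝ) (r : ℝ) (ω : Plane) : ℝ :=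
  4 ^ n / 4 * radialPart n P Q (r / 4) ω

/-- The angular component of the conjugate field in polar coordinates, up to a power of the
radius. -/
noncomputable def angularCoeff (n : ℕ) (P Q : MvPolynomial (Fin 2) ℝ) (r : ℝ) (ω : Plane) : ℝ :=
  4 ^ n / 16 * angularPart n P Q (r / 4) ω

lemma contDiff_radialCoeff (n : ℕ) (P Q : MvPolynomial (Fin 2) ℝ) :
    ContDiff ℝ 1 fun q : ℝ × Plane => radialCoeff n P Q q.1 q.2 :=
  contDiff_const.mul ((contDiff_radialPart n P Q).comp
    (by fun_prop : ContDiff ℝ 1 fun q : ℝ × Plane => (q.1 / 4, q.2)))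

lemma contDiff_angularCoeff (n : ℕ) (P Q : MvPolynomial (Fin 2) ℝ) :
    ContDiff ℝ 1 fun q : ℝ × Plane => angularCoeff n P Q q.1 q.2 :=
  contDiff_const.mul ((contDiff_angularPart n P Q).comp
    (by fun_prop : ContDiff ℝ 1 fun q : ℝ × Plane => (q.1 / 4, q.2)))

section

variable {n : ℕ} {P Q : MvPolynomial (Fin 2) ℝ}

/-- The transformed field in polar coordinates. -/
lemma pow_smul_bendixsonField_polar (hP : P.totalDegree ≤ n) (hQ : Q.totalDegree ≤ n)
    (hsing : IsProjectivelySingular n P Q) {r : ℝ} (hr : 0 < r) {ω : Plane} (hω : ‖ω‖ = 1) :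
    r ^ n • bendixsonField P Q (r • ω) = r ^ 2 •
      (-radialCoeff n P Q r ω • ω + (r * angularCoeff n P Q r ω) • quarterTurn ω) := by
  have hr0 : r / 4 ≠ 0 := by positivity
  -- The inversion sends rω to (4 / r)ω, so the homogenizing variable is r / 4; this is the source
  -- of the powers of 4.
  have harg : (4 / ((r • ω) 0 ^ 2 + (r • ω) 1 ^ 2)) • r • ω = (r / 4)⁻¹ • ω := by
    have : (r • ω) 0 ^ 2 + (r • ω) 1 ^ 2 = r ^ 2 := by
      simp only [PiLp.smul_apply, smul_eq_mul, mul_pow, ← mul_add, sum_sq_eq_one hω, mul_one]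
    rw [this, smul_smul]
    congr 1
    field_simp
  have h4 : (r : ℝ) ^ n = 4 ^ n * (r / 4) ^ n := by rw [← mul_pow]; congr 1; ring
  have hF0 := pow_mul_eval_inv_smul hP hr0 ω
  have hF1 := pow_mul_eval_inv_smul hQ hr0 ω
  have hang := hsing.angular_eq (r / 4) ω
  unfold bendixsonField
  simp only [harg, planeField]
  set f := MvPolynomial.eval (fun i => ((r / 4)⁻¹ • ω) i) P
  set g := MvPolynomial.eval (fun i => ((r / 4)⁻¹ • ω) i) Q
  unfold radialCoeff angularCoeff radialPart
  have hang' : r * angularPart n P Q (r / 4) ω = 4 * (ω 0 * homogenizedEval n Q (r / 4) ω -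
      ω 1 * homogenizedEval n P (r / 4) ω) := by rw [hang]; ring
  have hang'' : r * (4 ^ n / 16 * angularPart n P Q (r / 4) ω) =
      4 ^ n / 4 * (ω 0 * homogenizedEval n Q (r / 4) ω -
      ω 1 * homogenizedEval n P (r / 4) ω) := by
    linear_combination (4 ^ n / 16 : ℝ) * hang'
  rw [hang'', ← hF0, ← hF1]
  ext i
  fin_cases i
  · simp
    rw [h4]
    ring
  · simp
    rw [h4]
    ring

open MvPolynomial in
/-- The polynomial `∑ 4 ^ k (u² + v²) ^ (n - k) p_k(u, v)`, where `p_k` are the homogeneous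
components of `p`. -/
noncomputable def invertedPolynomial (n : ℕ) (p : MvPolynomial (Fin 2) ℝ) :
    MvPolynomial (Fin 2) ℝ :=
  ∑ k ∈ Finset.range (n + 1),
    C (4 ^ k) * (X 0 ^ 2 + X 1 ^ 2) ^ (n - k) * homogeneousComponent k p

lemma eval_invertedPolynomial {p : MvPolynomial (Fin 2) ℝ} (hp : p.totalDegree ≤ n) {w : Plane}
    (hw : w ≠ 0) :
    MvPolynomial.eval (fun i => w i) (invertedPolynomial n p) = (w 0 ^ 2 + w 1 ^ 2) ^ n *
      MvPolynomial.eval (fun i => ((4 / (w 0 ^ 2 + w 1 ^ 2)) • w) i) p := by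
  have hs : w 0 ^ 2 + w 1 ^ 2 ≠ 0 := by
    rw [← norm_sq_plane]; exact pow_ne_zero 2 (norm_ne_zero_iff.2 hw)
  set s := w 0 ^ 2 + w 1 ^ 2 with hsdef
  have h1 : (4 / s) • w = (s / 4)⁻¹ • w := by rw [inv_div]
  have h2 : s ^ n = 4 ^ n * (s / 4) ^ n := by rw [← mul_pow]; congr 1; ring
  rw [h1, h2, mul_assoc, pow_mul_eval_inv_smul hp (div_ne_zero hs four_ne_zero), homogenizedEval,
    Finset.mul_sum, invertedPolynomial, map_sum]
  refine Finset.sum_congr rfl fun k hk => ?_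
  have hk : k ≤ n := Nat.lt_succ_iff.1 (Finset.mem_range.1 hk)
  simp only [map_mul, map_pow, map_add, MvPolynomial.eval_X, MvPolynomial.eval_C, ← hsdef]
  have h4 : (4 : ℝ) ^ n = 4 ^ (n - k) * 4 ^ k := by rw [← pow_add, Nat.sub_add_cancel hk]
  rw [h4, div_pow]
  field_simp

open MvPolynomial in
-- The exponent n clears all denominators but need not be the reduced one; it starts the search for
-- the least exponent.
lemma exists_polynomial_conjugate (hP : P.totalDegree ≤ n) (hQ : Q.totalDegree ≤ n) :
    ∃ U V : MvPolynomial (Fin 2) ℝ, ∀ w : Plane, w ≠ 0 →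
      planeField U V w = ((w 0 ^ 2 + w 1 ^ 2) ^ n) • bendixsonField P Q w := by
  refine ⟨-(C (1 / 4) * (X 0 ^ 2 - X 1 ^ 2)) * invertedPolynomial n P -
      C (1 / 2) * X 0 * X 1 * invertedPolynomial n Q,
    -(C (1 / 2) * X 0 * X 1) * invertedPolynomial n P +
      C (1 / 4) * (X 0 ^ 2 - X 1 ^ 2) * invertedPolynomial n Q, fun w hw => ?_⟩
  unfold bendixsonField
  simp only [planeField, map_sub, map_add, map_mul, map_neg, map_pow, eval_X, eval_C,
    eval_invertedPolynomial hP hw, eval_invertedPolynomial hQ hw]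
  ext i
  fin_cases i
  · simp
    ring
  · simp
    ring

lemma smul_ne_zero_of_norm_eq_one {r : ℝ} (hr : 0 < r) {ω : Plane} (hω : ‖ω‖ = 1) :
    r • ω ≠ 0 := by
  rw [← norm_ne_zero_iff, norm_smul, hω, mul_one]
  exact norm_ne_zero_iff.2 hr.ne'

lemma sum_sq_smul {r : ℝ} {ω : Plane} (hω : ‖ω‖ = 1) :
    (r • ω) 0 ^ 2 + (r • ω) 1 ^ 2 = r ^ 2 := by
  rw [← norm_sq_plane, norm_smul, hω, mul_one, Real.norm_eq_abs, sq_abs]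

/-! ### Sign of the leading radial term and the node at infinity -/

/-- The limit of the bracket in the polar form of the conjugate field is the (nonzero) leading
radial term. -/
lemma radialCoeff_zero_eq_zero_of_pow_smul {G : Plane → Plane} (hG : Continuous G) {e : ℕ}
    (he : 1 ≤ e) {ω : Plane} (hω : ‖ω‖ = 1)
    (h : ∀ r > 0, r ^ e • G (r • ω) =
      -radialCoeff n P Q r ω • ω + (r * angularCoeff n P Q r ω) • quarterTurn ω) :
    radialCoeff n P Q 0 ω = 0 := by
  have hα : Continuous fun r => radialCoeff n P Q r ω :=
    (contDiff_radialCoeff n P Q).continuous.comp (continuous_id.prodMk continuous_const)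
  have hβ : Continuous fun r => angularCoeff n P Q r ω :=
    (contDiff_angularCoeff n P Q).continuous.comp (continuous_id.prodMk continuous_const)
  have h1 : Continuous fun r : ℝ => r ^ e • G (r • ω) :=
    (continuous_pow e).smul (hG.comp (by fun_prop))
  have h2 : Continuous fun r : ℝ => -radialCoeff n P Q r ω • ω +
      (r * angularCoeff n P Q r ω) • quarterTurn ω := by fun_prop
  -- As r → 0⁺ the left side vanishes because e ≥ 1, and the angular term carries a factor r; only
  -- the radial term at r = 0 is left.
  have h3 := tendsto_nhds_unique ((h1.tendsto 0).mono_left (nhdsWithin_le_nhds (s := Ioi 0)))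
    (((h2.tendsto 0).mono_left nhdsWithin_le_nhds).congr' (by
      filter_upwards [self_mem_nhdsWithin] with r hr
      exact (h r hr).symm))
  rw [zero_pow (Nat.one_le_iff_ne_zero.1 he), zero_smul, zero_mul, zero_smul, add_zero, neg_smul,
    zero_eq_neg] at h3
  refine (smul_eq_zero.1 h3).resolve_right fun h0 => ?_
  rw [h0, norm_zero] at hω
  exact zero_ne_one hω

lemma radialCoeff_zero_ne_zero (h : ∀ ω : Plane, ‖ω‖ = 1 → radialPart n P Q 0 ω ≠ 0) {ω : Plane}
    (hω : ‖ω‖ = 1) : radialCoeff n P Q 0 ω ≠ 0 := by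
  rw [radialCoeff, zero_div]
  exact mul_ne_zero (by positivity) (h ω hω)

lemma radialPart_zero_neg (ω : Plane) :
    radialPart n P Q 0 (-ω) = (-1) ^ (n + 1) * radialPart n P Q 0 ω := by
  rw [radialPart_zero, radialPart_zero, ← (isHomogeneous_radial n P Q).eval_smul]
  congr 1
  congr 1
  ext i
  simp

lemma continuous_radialPart_unitVector :
    Continuous fun θ => radialPart n P Q 0 (unitVector θ) :=
  (contDiff_radialPart n P Q).continuous.comp
    (continuous_const.prodMk contDiff_unitVector.continuous)

/-- If the leading radial term has no zero on the unit circle, it has constant sign. -/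
lemma radialPart_pos_or_neg (h : ∀ ω : Plane, ‖ω‖ = 1 → radialPart n P Q 0 ω ≠ 0) :
    (∀ ω : Plane, ‖ω‖ = 1 → 0 < radialPart n P Q 0 ω) ∨
      (∀ ω : Plane, ‖ω‖ = 1 → radialPart n P Q 0 ω < 0) := by
  by_contra! hcon
  obtain ⟨⟨ω₁, hω₁, h₁⟩, ω₂, hω₂, h₂⟩ := hcon
  obtain ⟨θ₁, -, rfl⟩ := exists_unitVector_eq hω₁
  obtain ⟨θ₂, -, rfl⟩ := exists_unitVector_eq hω₂
  obtain ⟨θ, hθ⟩ := mem_range_of_exists_le_of_exists_ge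
    (continuous_radialPart_unitVector (n := n) (P := P) (Q := Q)) ⟨θ₁, h₁⟩ ⟨θ₂, h₂⟩
  exact h _ (norm_unitVector θ) hθ

/-- If the leading radial term has no zero on the unit circle, then the degree is odd. -/
lemma odd_of_radialPart_ne_zero (h : ∀ ω : Plane, ‖ω‖ = 1 → radialPart n P Q 0 ω ≠ 0) :
    Odd n := by
  rw [← Nat.not_even_iff_odd]
  intro hn
  -- For even n the leading radial term has odd degree n + 1 and takes opposite signs at antipodal
  -- points.
  have hneg := radialPart_zero_neg (n := n) (P := P) (Q := Q) (unitVector 0)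
  rw [hn.add_one.neg_one_pow] at hneg
  have h0 : ‖-unitVector 0‖ = 1 := by rw [norm_neg, norm_unitVector]
  rcases radialPart_pos_or_neg h with h | h
  · linarith [h _ (norm_unitVector 0), h _ h0]
  · linarith [h _ (norm_unitVector 0), h _ h0]

open MvPolynomial in
/-- The stereographically conjugate system exists. -/
lemma exists_isStereographicConjugate (hP : P.totalDegree ≤ n) (hQ : Q.totalDegree ≤ n)
    (hsing : IsProjectivelySingular n P Q)
    (h : ∀ ω : Plane, ‖ω‖ = 1 → radialPart n P Q 0 ω ≠ 0) :
    ∃ (m : ℕ) (U V : MvPolynomial (Fin 2) ℝ), IsStereographicConjugate P Q m U V := by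
  classical
  have hex : ∃ m : ℕ, ∃ U V : MvPolynomial (Fin 2) ℝ, ∀ w : Plane, w ≠ 0 →
      planeField U V w = ((w 0 ^ 2 + w 1 ^ 2) ^ m) • bendixsonField P Q w :=
    ⟨n, exists_polynomial_conjugate hP hQ⟩
  -- The least exponent is reduced: a common factor u² + v² would cancel one power. If that exponent
  -- is 0, cancelling r² leaves r^n times a continuous field equal to the bracket, with n ≥ 1 since
  -- n is odd, and the leading radial term would vanish.
  obtain ⟨U, V, hUV⟩ := Nat.find_spec hex
  refine ⟨Nat.find hex, U, V, hUV, ?_⟩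
  rintro ⟨⟨U', rfl⟩, ⟨V', rfl⟩⟩
  have hfac : ∀ w : Plane, planeField ((X 0 ^ 2 + X 1 ^ 2) * U') ((X 0 ^ 2 + X 1 ^ 2) * V') w =
      (w 0 ^ 2 + w 1 ^ 2) • planeField U' V' w := fun w => by
    ext i
    fin_cases i <;> simp [planeField]
  have hne : ∀ w : Plane, w ≠ 0 → w 0 ^ 2 + w 1 ^ 2 ≠ 0 := fun w hw => by
    rw [← norm_sq_plane]; exact pow_ne_zero 2 (norm_ne_zero_iff.2 hw)
  rcases Nat.eq_zero_or_eq_succ_pred (Nat.find hex) with hm | hm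
  · rw [hm] at hUV
    refine radialCoeff_zero_ne_zero h (norm_unitVector 0)
      (radialCoeff_zero_eq_zero_of_pow_smul (contDiff_planeField U' V').continuous
        (odd_of_radialPart_ne_zero h).pos (norm_unitVector 0) fun r hr => ?_)
    have h1 := pow_smul_bendixsonField_polar hP hQ hsing hr (norm_unitVector 0)
    have h2 := hUV _ (smul_ne_zero_of_norm_eq_one hr (norm_unitVector 0))
    rw [hfac, sum_sq_smul (norm_unitVector 0), pow_zero, one_smul] at h2
    rw [← h2, smul_comm] at h1
    exact smul_right_injective _ (pow_ne_zero 2 hr.ne') h1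
  · refine Nat.find_min hex (m := (Nat.find hex).pred) (by omega) ⟨U', V', fun w hw => ?_⟩
    have h2 := hUV w hw
    rw [hfac, hm, Nat.succ_eq_add_one, pow_succ' _ (Nat.find hex).pred, mul_smul] at h2
    exact smul_right_injective _ (hne w hw) h2

/-- If the leading radial term has no zero on the unit circle, then the point at infinity is a
dicritical node. -/
theorem isDicriticalNodeAtInfinity_of_radialPart_ne_zero (hP : P.totalDegree ≤ n)
    (hQ : Q.totalDegree ≤ n) (hsing : IsProjectivelySingular n P Q)
    (h : ∀ ω : Plane, ‖ω‖ = 1 → radialPart n P Q 0 ω ≠ 0) :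
    IsDicriticalNodeAtInfinity P Q := by
  refine ⟨exists_isStereographicConjugate hP hQ hsing h, fun m U V hUV => ?_⟩
  have hodd := odd_of_radialPart_ne_zero h
  have hpolar : ∀ r > 0, ∀ ω : Plane, ‖ω‖ = 1 → r ^ n • planeField U V (r • ω) =
      r ^ (2 * m + 2) • (-radialCoeff n P Q r ω • ω +
        (r * angularCoeff n P Q r ω) • quarterTurn ω) := fun r hr ω hω => by
    rw [hUV.field_eq _ (smul_ne_zero_of_norm_eq_one hr hω), sum_sq_smul hω, smul_comm,
      pow_smul_bendixsonField_polar hP hQ hsing hr hω, smul_smul, ← pow_mul, ← pow_add]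
  have hnm : n ≤ 2 * m + 2 := by
    by_contra! hlt
    refine radialCoeff_zero_ne_zero h (norm_unitVector 0)
      (radialCoeff_zero_eq_zero_of_pow_smul (contDiff_planeField U V).continuous
        (e := n - (2 * m + 2)) (by omega) (norm_unitVector 0) fun r hr => ?_)
    refine smul_right_injective _ (pow_ne_zero (2 * m + 2) hr.ne') ?_
    simp only
    rw [← hpolar r hr _ (norm_unitVector 0), smul_smul, ← pow_add, Nat.add_sub_cancel' hlt.le]
  -- Parity makes n ≤ 2m + 2 strict, so the exponent 2m + 2 - n is at least 1.
  obtain ⟨k, hk⟩ := hodd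
  have hform : ∀ r > 0, ∀ ω : Plane, ‖ω‖ = 1 → planeField U V (r • ω) =
      r ^ (2 * m + 2 - n) • (-radialCoeff n P Q r ω • ω +
        (r * angularCoeff n P Q r ω) • quarterTurn ω) := fun r hr ω hω => by
    refine smul_right_injective _ (pow_ne_zero n hr.ne') ?_
    simp only
    rw [hpolar r hr ω hω, smul_smul, ← pow_add, Nat.add_sub_cancel' hnm]
  have hG := contDiff_planeField U V
  have hα := contDiff_radialCoeff n P Q
  have hβ := contDiff_angularCoeff n P Q
  rcases radialPart_pos_or_neg h with hpos | hneg
  · left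
    refine isStableDicriticalNode_of_polar_form hG (d := 2 * m + 2 - n) (by omega) hα hβ
      (fun ω hω => ?_) hform
    rw [radialCoeff, zero_div]
    exact mul_pos (by positivity) (hpos ω hω)
  · right
    refine isStableDicriticalNode_of_polar_form hG.neg (d := 2 * m + 2 - n) (by omega)
      (α := fun r ω => -radialCoeff n P Q r ω) (β := fun r ω => -angularCoeff n P Q r ω)
      hα.neg hβ.neg (fun ω hω => ?_) fun r hr ω hω => ?_
    · rw [radialCoeff, zero_div]
      exact neg_pos.2 (mul_neg_of_pos_of_neg (by positivity) (hneg ω hω))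
    · rw [hform r hr ω hω, ← smul_neg]
      congr 1
      module

/-! ### The polynomial extension to the projective disc -/

/-- The projection of space to the plane of the first two coordinates. -/
def planarPart (p : Space) : Plane := !₂[p 0, p 1]

/-- The polynomial field in space that extends a projectively singular system to the closed
projective disc. -/
noncomputable def discField (n : ℕ) (P Q : MvPolynomial (Fin 2) ℝ) (p : Space) : Space :=
  !₂[p 2 * homogenizedEval n P (p 2) (planarPart p) - p 1 * angularPart n P Q (p 2) (planarPart p),
    p 2 * homogenizedEval n Q (p 2) (planarPart p) + p 0 * angularPart n P Q (p 2) (planarPart p),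
    -radialPart n P Q (p 2) (planarPart p)]

lemma norm_sq_space (p : Space) : ‖p‖ ^ 2 = p 0 ^ 2 + p 1 ^ 2 + p 2 ^ 2 := by
  simp [EuclideanSpace.norm_sq_eq, Fin.sum_univ_three]

lemma norm_sq_planarPart (p : Space) : ‖planarPart p‖ ^ 2 = p 0 ^ 2 + p 1 ^ 2 := by
  rw [norm_sq_plane]; rfl

lemma inner_space (p q : Space) : inner ℝ p q = p 0 * q 0 + p 1 * q 1 + p 2 * q 2 := by
  simp [PiLp.inner_apply, Fin.sum_univ_three, mul_comm]

lemma contDiff_discField : ContDiff ℝ 1 (discField n P Q) := by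
  have hc : ∀ i, ContDiff ℝ 1 fun p : Space => p i := fun i => by fun_prop
  have hpl : ContDiff ℝ 1 fun p : Space => (p 2, planarPart p) := by
    refine (hc 2).prodMk (contDiff_euclidean.2 fun i => ?_)
    fin_cases i
    · exact hc 0
    · exact hc 1
  have hP := (contDiff_homogenizedEval n P).comp hpl
  have hQ := (contDiff_homogenizedEval n Q).comp hpl
  have hA := (contDiff_radialPart n P Q).comp hpl
  have hW := (contDiff_angularPart n P Q).comp hpl
  rw [contDiff_euclidean]
  intro i
  fin_cases i
  · exact ((hc 2).mul hP).sub ((hc 1).mul hW)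
  · exact ((hc 2).mul hQ).add ((hc 0).mul hW)
  · exact hA.neg

/-- Tangency to the sphere keeps the integral curves of `discField` on it. -/
lemma inner_discField (p : Space) : inner ℝ p (discField n P Q p) = 0 := by
  rw [inner_space]
  simp [discField, radialPart, planarPart]
  ring

lemma centralProjection_inv_smul_planarPart {p : Space} (hp : ‖p‖ = 1) (hp2 : 0 < p 2) :
    centralProjection ((p 2)⁻¹ • planarPart p) = p := by
  have h1 : 1 + ‖(p 2)⁻¹ • planarPart p‖ ^ 2 = ((p 2)⁻¹) ^ 2 := by
    rw [norm_smul, mul_pow, norm_sq_planarPart, Real.norm_eq_abs, sq_abs]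
    have := norm_sq_space p
    rw [hp] at this
    field_simp
    linarith
  rw [centralProjection, h1, Real.sqrt_sq (inv_pos.2 hp2).le, inv_inv]
  ext i
  fin_cases i <;> simp [planarPart, hp2.ne']

lemma fderiv_centralProjection (z v : Plane) :
    fderiv ℝ centralProjection z v = (Real.sqrt (1 + ‖z‖ ^ 2))⁻¹ •
      (!₂[v 0, v 1, 0] - ((Real.sqrt (1 + ‖z‖ ^ 2))⁻¹ ^ 2 * inner ℝ z v) • !₂[z 0, z 1, 1]) := by
  have hpos : 0 < 1 + ‖z‖ ^ 2 := by positivity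
  have hd : DifferentiableAt ℝ centralProjection z := by
    have h1 : DifferentiableAt ℝ (fun z : Plane => (Real.sqrt (1 + ‖z‖ ^ 2))⁻¹) z := by
      have h2 : DifferentiableAt ℝ (fun z : Plane => 1 + ‖z‖ ^ 2) z :=
        (differentiableAt_const _).add (differentiableAt_id.norm_sq ℝ)
      exact (h2.sqrt hpos.ne').inv (Real.sqrt_pos.2 hpos).ne'
    refine h1.smul (differentiableAt_euclidean.2 fun i => ?_)
    fin_cases i <;> simp <;> fun_prop
  have hline : HasDerivAt (fun t : ℝ => z + t • v) v 0 := by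
    simpa using ((hasDerivAt_id (0 : ℝ)).smul_const v).const_add z
  have h1 : HasDerivAt (fun t : ℝ => centralProjection (z + t • v))
      (fderiv ℝ centralProjection z v) 0 := by
    have : HasFDerivAt centralProjection (fderiv ℝ centralProjection z) (z + (0 : ℝ) • v) := by
      simpa using hd.hasFDerivAt
    exact this.comp_hasDerivAt 0 hline
  have hN : HasDerivAt (fun t : ℝ => 1 + ‖z + t • v‖ ^ 2) (2 * inner ℝ z v) 0 := by
    simpa using hline.norm_sq.const_add 1
  have hpos' : 0 < 1 + ‖z + (0 : ℝ) • v‖ ^ 2 := by positivity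
  have hinv := (hN.sqrt hpos'.ne').inv (Real.sqrt_pos.2 hpos').ne'
  have h2 : HasDerivAt (fun t : ℝ => (!₂[(z + t • v) 0, (z + t • v) 1, 1] : Space))
      !₂[v 0, v 1, 0] 0 := by
    rw [hasDerivAt_euclidean] at hline ⊢
    intro i
    fin_cases i
    · exact hline 0
    · exact hline 1
    · exact hasDerivAt_const _ _
  have h3 := h1.unique (hinv.smul h2)
  rw [h3]
  have hs := Real.sq_sqrt hpos.le
  have hs0 := (Real.sqrt_pos.2 hpos).ne'
  ext i
  fin_cases i
  all_goals
    simp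
    field_simp
    try ring

/-- The extension of the field in the interior of the disc. -/
lemma smul_fderiv_centralProjection (hP : P.totalDegree ≤ n) (hQ : Q.totalDegree ≤ n)
    (hsing : IsProjectivelySingular n P Q) {p : Space} (hp : ‖p‖ = 1) (hp2 : 0 < p 2) :
    p 2 ^ n • fderiv ℝ centralProjection ((p 2)⁻¹ • planarPart p)
      (planeField P Q ((p 2)⁻¹ • planarPart p)) = p 2 ^ 2 • discField n P Q p := by
  have hc := hp2.ne'
  have hproj := centralProjection_inv_smul_planarPart hp hp2
  have hF0 := pow_mul_eval_inv_smul hP hc (planarPart p)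
  have hF1 := pow_mul_eval_inv_smul hQ hc (planarPart p)
  have hang := hsing.angular_eq (p 2) (planarPart p)
  have hn := norm_sq_space p
  rw [hp] at hn
  have hz : (Real.sqrt (1 + ‖(p 2)⁻¹ • planarPart p‖ ^ 2))⁻¹ = p 2 := by
    have := congrArg (fun q : Space => q 2) hproj
    simpa only [centralProjection, PiLp.smul_apply, smul_eq_mul, Matrix.cons_val, mul_one] using this
  rw [fderiv_centralProjection, hz, inner_plane]
  unfold discField radialPart
  simp only [planeField]
  set f := MvPolynomial.eval (fun i => ((p 2)⁻¹ • planarPart p) i) P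
  set g := MvPolynomial.eval (fun i => ((p 2)⁻¹ • planarPart p) i) Q
  set a := homogenizedEval n P (p 2) (planarPart p)
  set b := homogenizedEval n Q (p 2) (planarPart p)
  set W := angularPart n P Q (p 2) (planarPart p)
  have hp0 : (planarPart p) 0 = p 0 := rfl
  have hp1 : (planarPart p) 1 = p 1 := rfl
  rw [hp0, hp1] at hang
  -- Write c for p 2. On the unit sphere the tangential projection of (a, b, 0) has horizontal part
  -- c²(a, b) + (p₀b - p₁a)(-p₁, p₀) and vertical part -c(p₀a + p₁b). By `hang`, p₀b - p₁a = cW, so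
  -- every component gains a factor c.
  ext i
  fin_cases i
  · simp [hp0, hp1]
    field_simp
    linear_combination (1 - p 0 ^ 2) * hF0 - p 0 * p 1 * hF1 + a * hn - p 1 * hang
  · simp [hp0, hp1]
    field_simp
    linear_combination (1 - p 1 ^ 2) * hF1 - p 0 * p 1 * hF0 + b * hn + p 0 * hang
  · simp [hp0, hp1]
    field_simp
    linear_combination -p 0 * hF0 - p 1 * hF1

/-- In the interior of the disc the extension is the polynomial field up to a power of the
height. -/
lemma IsDiscExtension.exists_eq_zpow_smul {Φ : Space → Space} (hΦ : IsDiscExtension P Q Φ)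
    (hP : P.totalDegree ≤ n) (hQ : Q.totalDegree ≤ n) (hsing : IsProjectivelySingular n P Q) :
    ∃ k : ℤ, ∀ p : Space, ‖p‖ = 1 → 0 < p 2 → Φ p = (p 2) ^ k • discField n P Q p := by
  obtain ⟨j, hj⟩ := hΦ.interior
  refine ⟨j + 2 - n, fun p hp hp2 => ?_⟩
  have h1 := hj ((p 2)⁻¹ • planarPart p)
  rw [centralProjection_inv_smul_planarPart hp hp2] at h1
  have h2 := smul_fderiv_centralProjection hP hQ hsing hp hp2
  refine smul_right_injective _ (pow_ne_zero n hp2.ne') ?_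
  simp only
  rw [h1, smul_comm, h2, smul_smul, smul_smul, ← zpow_natCast, ← zpow_natCast, ← zpow_add₀ hp2.ne',
    ← zpow_add₀ hp2.ne']
  congr 2
  push_cast
  ring

/-- An arc of the disc that ends at the boundary point `p`. -/
noncomputable def boundaryArc (p : Space) (ε : ℝ) : Space :=
  !₂[Real.sqrt (1 - ε ^ 2) * p 0, Real.sqrt (1 - ε ^ 2) * p 1, ε]

lemma continuous_boundaryArc (p : Space) : Continuous (boundaryArc p) := by
  unfold boundaryArc
  fun_prop

lemma boundaryArc_zero {p : Space} (hp : p ∈ boundaryCircle) : boundaryArc p 0 = p := by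
  ext i
  fin_cases i <;> simp [boundaryArc, hp.2]

lemma norm_boundaryArc {p : Space} (hp : p ∈ boundaryCircle) {ε : ℝ} (hε : ε ^ 2 ≤ 1) :
    ‖boundaryArc p ε‖ = 1 := by
  have h1 := norm_sq_space p
  rw [hp.1, hp.2] at h1
  have h2 : ‖boundaryArc p ε‖ ^ 2 = 1 := by
    rw [norm_sq_space]
    simp only [boundaryArc, Matrix.cons_val, mul_pow, Real.sq_sqrt (sub_nonneg.2 hε)]
    linear_combination -(1 - ε ^ 2) * h1
  nlinarith [norm_nonneg (boundaryArc p ε)]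

lemma eventually_boundaryArc {p : Space} (hp : p ∈ boundaryCircle) :
    ∀ᶠ ε in 𝓝[>] (0 : ℝ), 0 < ε ∧ ‖boundaryArc p ε‖ = 1 := by
  filter_upwards [self_mem_nhdsWithin, mem_nhdsWithin_of_mem_nhds (gt_mem_nhds one_pos)]
    with ε (h0 : 0 < ε) h1
  exact ⟨h0, norm_boundaryArc hp (by nlinarith)⟩

/-- The formula for an extension is known only in the interior; boundary values are recovered as
limits along arcs on which the height is ε. -/
lemma tendsto_boundaryArc_of_continuousOn {f : Space → Space} (hf : ContinuousOn f projectiveDisc)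
    {p : Space} (hp : p ∈ boundaryCircle) :
    Tendsto (fun ε => f (boundaryArc p ε)) (𝓝[>] 0) (𝓝 (f p)) := by
  have h1 : ContinuousWithinAt f projectiveDisc p := hf p ⟨hp.1, hp.2.ge⟩
  refine h1.tendsto.comp (tendsto_nhdsWithin_iff.2 ⟨?_, ?_⟩)
  · have := ((continuous_boundaryArc p).tendsto 0).mono_left (nhdsWithin_le_nhds (s := Ioi 0))
    rwa [boundaryArc_zero hp] at this
  · filter_upwards [eventually_boundaryArc hp] with ε hε
    exact ⟨hε.2, hε.1.le⟩

/-- The extension of a projectively singular system coincides with the polynomial field. -/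
lemma IsDiscExtension.eqOn_discField {Φ : Space → Space} (hΦ : IsDiscExtension P Q Φ)
    (hP : P.totalDegree ≤ n) (hQ : Q.totalDegree ≤ n) (hsing : IsProjectivelySingular n P Q)
    (hne : ∃ p ∈ boundaryCircle, discField n P Q p ≠ 0) :
    EqOn Φ (discField n P Q) projectiveDisc := by
  obtain ⟨k, hk⟩ := hΦ.exists_eq_zpow_smul hP hQ hsing
  have hΨ : ContinuousOn (discField n P Q) projectiveDisc :=
    contDiff_discField.continuous.continuousOn
  have hpow : ∀ m : ℕ, m ≠ 0 → Tendsto (fun ε : ℝ => ε ^ m) (𝓝[>] 0) (𝓝 0) := fun m hm => by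
    simpa [zero_pow hm] using ((continuous_pow m).tendsto (0 : ℝ)).mono_left
      (nhdsWithin_le_nhds (s := Ioi 0))
  -- A negative k would force `discField` to vanish on the whole circle, a positive k would force Φ
  -- to vanish there.
  have hk0 : k = 0 := by
    rcases lt_trichotomy k 0 with hlt | h0 | hgt
    · exfalso
      obtain ⟨p, hp, hp0⟩ := hne
      obtain ⟨m, hm⟩ := Int.eq_ofNat_of_zero_le (neg_nonneg.2 hlt.le)
      have h1 := (hpow m (by omega)).smul (tendsto_boundaryArc_of_continuousOn hΦ.continuousOn hp)
      rw [zero_smul] at h1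
      refine hp0 (tendsto_nhds_unique (tendsto_boundaryArc_of_continuousOn hΨ hp)
        (h1.congr' ?_))
      filter_upwards [eventually_boundaryArc hp] with ε hε
      have h2 : boundaryArc p ε 2 = ε := rfl
      rw [hk _ hε.2 hε.1, h2, smul_smul, ← zpow_natCast, ← zpow_add₀ hε.1.ne', ← hm,
        neg_add_cancel, zpow_zero, one_smul]
    · exact h0
    · exfalso
      obtain ⟨p, hp, hp0⟩ := hΦ.boundary
      obtain ⟨m, rfl⟩ := Int.eq_ofNat_of_zero_le hgt.le
      have h1 := (hpow m (by omega)).smul (tendsto_boundaryArc_of_continuousOn hΨ hp)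
      rw [zero_smul] at h1
      refine hp0 (tendsto_nhds_unique (tendsto_boundaryArc_of_continuousOn hΦ.continuousOn hp)
        (h1.congr' ?_))
      filter_upwards [eventually_boundaryArc hp] with ε hε
      have h2 : boundaryArc p ε 2 = ε := rfl
      rw [hk _ hε.2 hε.1, h2, zpow_natCast]
  subst hk0
  have hint : ∀ p : Space, ‖p‖ = 1 → 0 < p 2 → Φ p = discField n P Q p := fun p hp hp2 => by
    rw [hk p hp hp2, zpow_zero, one_smul]
  intro p hp
  rcases hp.2.lt_or_eq with hlt | heq
  · exact hint p hp.1 hlt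
  · have hpb : p ∈ boundaryCircle := ⟨hp.1, heq.symm⟩
    refine tendsto_nhds_unique (tendsto_boundaryArc_of_continuousOn hΦ.continuousOn hpb)
      ((tendsto_boundaryArc_of_continuousOn hΨ hpb).congr' ?_)
    filter_upwards [eventually_boundaryArc hpb] with ε hε
    exact (hint _ hε.2 hε.1).symm

/-! ### Trajectories at the boundary circle and orthogonality -/

/-- A function that vanishes at `0` with a nonzero derivative is nonnegative on a one-sided
neighbourhood of `0`. -/
lemma exists_interval_nonneg_of_hasDerivAt {f : ℝ → ℝ} {f' : ℝ} (hf : HasDerivAt f f' 0)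
    (h0 : f 0 = 0) (hf' : f' ≠ 0) {ε : ℝ} (hε : 0 < ε) :
    ∃ a b : ℝ, a < b ∧ (0 : ℝ) ∈ Icc a b ∧ Icc a b ⊆ Ioo (-ε) ε ∧ ∀ t ∈ Icc a b, 0 ≤ f t := by
  have hslope := hasDerivAt_iff_tendsto_slope.1 hf
  have hslope' : ∀ t, slope f 0 t = t⁻¹ * f t := fun t => by
    rw [slope_def_field, h0, sub_zero, sub_zero, div_eq_inv_mul]
  rcases hf'.lt_or_gt with hneg | hpos
  · have hev := hslope.eventually (gt_mem_nhds hneg)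
    rw [eventually_nhdsWithin_iff, Metric.eventually_nhds_iff_ball] at hev
    obtain ⟨η, hη, hball⟩ := hev
    have hm : 0 < min ε η := lt_min hε hη
    have h1 := min_le_left ε η
    have h2 := min_le_right ε η
    refine ⟨-(min ε η / 2), 0, by linarith, ⟨by linarith, le_rfl⟩,
      fun t ht => ⟨by linarith [ht.1], by linarith [ht.2]⟩, fun t ht => ?_⟩
    rcases ht.2.lt_or_eq with htn | rfl
    · have h3 := hball t (by
        rw [mem_ball_zero_iff, Real.norm_eq_abs, abs_lt]
        exact ⟨by linarith [ht.1], by linarith⟩) htn.ne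
      rw [hslope'] at h3
      by_contra! h4
      linarith [mul_pos_of_neg_of_neg (inv_neg''.2 htn) h4]
    · exact h0.ge
  · have hev := hslope.eventually (lt_mem_nhds hpos)
    rw [eventually_nhdsWithin_iff, Metric.eventually_nhds_iff_ball] at hev
    obtain ⟨η, hη, hball⟩ := hev
    have hm : 0 < min ε η := lt_min hε hη
    have h1 := min_le_left ε η
    have h2 := min_le_right ε η
    refine ⟨0, min ε η / 2, by linarith, ⟨le_rfl, by linarith⟩,
      fun t ht => ⟨by linarith [ht.1], by linarith [ht.2]⟩, fun t ht => ?_⟩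
    rcases ht.1.lt_or_eq with htn | rfl
    · have h3 := hball t (by
        rw [mem_ball_zero_iff, Real.norm_eq_abs, abs_lt]
        exact ⟨by linarith, by linarith [ht.2]⟩) htn.ne'
      rw [hslope'] at h3
      by_contra! h4
      linarith [mul_neg_of_pos_of_neg (inv_pos.2 htn) h4]
    · exact h0.ge

/-- Through a boundary point at which the polynomial field is transversal to the boundary circle
there passes a trajectory in the closed disc. -/
lemma exists_discTrajectory {Φ : Space → Space} (hΦ : EqOn Φ (discField n P Q) projectiveDisc)
    {p : Space} (hp : p ∈ boundaryCircle) (hp2 : discField n P Q p 2 ≠ 0) :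
    ∃ (I : Set ℝ) (γ : ℝ → Space), IsDiscTrajectory Φ I γ ∧ (0 : ℝ) ∈ I ∧ γ 0 = p ∧
      derivWithin γ I 0 = discField n P Q p := by
  obtain ⟨γ, hγ0, ε, hε, hγ⟩ :=
    (contDiff_discField (n := n) (P := P) (Q := Q)).contDiffAt
      |>.exists_forall_mem_closedBall_exists_eq_forall_mem_Ioo_hasDerivAt₀ (x₀ := p) 0
  rw [zero_sub, zero_add] at hγ
  have h0 : (0 : ℝ) ∈ Ioo (-ε) ε := ⟨by linarith, hε⟩
  have hnorm : ∀ t ∈ Ioo (-ε) ε, ‖γ t‖ = 1 := by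
    have hd : ∀ t ∈ Ioo (-ε) ε, HasDerivAt (fun t => ‖γ t‖ ^ 2) 0 t := fun t ht => by
      have := (hγ t ht).norm_sq
      rwa [inner_discField, mul_zero] at this
    intro t ht
    have h1 : ‖γ t‖ ^ 2 = ‖γ 0‖ ^ 2 :=
      isOpen_Ioo.is_const_of_deriv_eq_zero isPreconnected_Ioo
        (fun u hu => (hd u hu).differentiableAt.differentiableWithinAt)
        (fun u hu => (hd u hu).deriv) ht h0
    rw [hγ0, hp.1] at h1
    nlinarith [norm_nonneg (γ t)]
  have hd2 : HasDerivAt (fun t => γ t 2) (discField n P Q p 2) 0 := by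
    have := hasDerivAt_euclidean.1 (hγ 0 h0) 2
    rwa [hγ0] at this
  -- The integral curve crosses the equator, so only one side of it need lie in the closed disc. On
  -- the nondegenerate interval kept here, `derivWithin` at 0 is still the value of the field.
  obtain ⟨a, b, hab, hmem, hsub, hnn⟩ := exists_interval_nonneg_of_hasDerivAt hd2
    (by simp only [hγ0, hp.2]) hp2 hε
  have hdisc : ∀ t ∈ Icc a b, γ t ∈ projectiveDisc := fun t ht => ⟨hnorm t (hsub ht), hnn t ht⟩
  refine ⟨Icc a b, γ, ⟨ordConnected_Icc,
    ⟨a, left_mem_Icc.2 hab.le, b, right_mem_Icc.2 hab.le, hab.ne⟩, hdisc,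
    fun t ht => ?_⟩, hmem, hγ0, ?_⟩
  · change HasDerivWithinAt γ (Φ (γ t)) _ _
    rw [hΦ (hdisc t ht)]
    exact (hγ t (hsub ht)).hasDerivWithinAt
  · rw [(hγ 0 h0).hasDerivWithinAt.derivWithin (uniqueDiffOn_Icc hab 0 hmem), hγ0]

lemma exists_norm_one_smul (w : Plane) : ∃ u : Plane, ‖u‖ = 1 ∧ w = ‖w‖ • u := by
  by_cases hw : w = 0
  · exact ⟨unitVector 0, norm_unitVector 0, by simp [hw]⟩
  · have hw' : ‖w‖ ≠ 0 := norm_ne_zero_iff.2 hw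
    refine ⟨‖w‖⁻¹ • w, ?_, ?_⟩
    · rw [norm_smul, norm_inv, norm_norm, inv_mul_cancel₀ hw']
    · rw [smul_smul, mul_inv_cancel₀ hw', one_smul]

/-- A homogeneous polynomial that vanishes on the unit circle is zero. -/
lemma MvPolynomial.IsHomogeneous.eq_zero_of_unit {p : MvPolynomial (Fin 2) ℝ} {k : ℕ}
    (hp : p.IsHomogeneous k)
    (h : ∀ ω : Plane, ‖ω‖ = 1 → MvPolynomial.eval (fun i => ω i) p = 0) : p = 0 := by
  refine hp.eq_zero_of_forall_eval_eq_zero fun x => ?_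
  obtain ⟨u, hu, hw⟩ := exists_norm_one_smul (WithLp.toLp 2 x)
  have hx : x = ‖WithLp.toLp 2 x‖ • (fun i => u i) := congrArg WithLp.ofLp hw
  rw [hx, hp.eval_smul, h u hu, mul_zero]

open MvPolynomial in
/-- The leading radial term of a projectively singular system does not vanish identically. -/
lemma IsPolynomialSystem.radial_ne_zero (hsys : IsPolynomialSystem n P Q)
    (hsing : IsProjectivelySingular n P Q) :
    (X 0 * homogeneousComponent n P + X 1 * homogeneousComponent n Q :
      MvPolynomial (Fin 2) ℝ) ≠ 0 := by
  intro h
  have hs : (X 0 ^ 2 + X 1 ^ 2 : MvPolynomial (Fin 2) ℝ) ≠ 0 := fun h0 => by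
    have := congrArg (eval (fun _ => (1 : ℝ))) h0
    norm_num at this
  unfold IsProjectivelySingular at hsing
  -- With A the radial and W_n the angular leading form, (x² + y²)P_n = xA - yW_n and (x² + y²)Q_n =
  -- yA + xW_n.
  rcases hsys.top_ne_zero with hP | hQ
  · refine mul_ne_zero hs hP ?_
    linear_combination (X 0 : MvPolynomial (Fin 2) ℝ) * h -
      (X 1 : MvPolynomial (Fin 2) ℝ) * hsing
  · refine mul_ne_zero hs hQ ?_
    linear_combination (X 1 : MvPolynomial (Fin 2) ℝ) * h +
      (X 0 : MvPolynomial (Fin 2) ℝ) * hsing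

/-- The boundary point of the disc in the direction `ω`. -/
def boundaryPoint (ω : Plane) : Space := !₂[ω 0, ω 1, 0]

lemma boundaryPoint_mem {ω : Plane} (hω : ‖ω‖ = 1) : boundaryPoint ω ∈ boundaryCircle := by
  refine ⟨?_, rfl⟩
  have h : ‖boundaryPoint ω‖ ^ 2 = 1 := by
    rw [norm_sq_space]
    simpa [boundaryPoint] using sum_sq_eq_one hω
  nlinarith [norm_nonneg (boundaryPoint ω)]

/-- At height 0 the angular part is the tangential velocity and the radial part, up to sign, the
normal one, so orthogonality to the circle concerns the angular part alone. -/
lemma discField_boundaryPoint (ω : Plane) : discField n P Q (boundaryPoint ω) =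
    !₂[-(ω 1 * angularPart n P Q 0 ω), ω 0 * angularPart n P Q 0 ω, -radialPart n P Q 0 ω] := by
  have h : planarPart (boundaryPoint ω) = ω := by
    ext i; fin_cases i <;> rfl
  have h2 : boundaryPoint ω 2 = 0 := rfl
  ext i
  fin_cases i <;> simp [discField, h, h2] <;> simp [boundaryPoint]

open MvPolynomial in
/-- If all trajectories meet the boundary circle orthogonally, then the leading radial term has no
zero on the unit circle. -/
theorem MeetsBoundaryCircleOrthogonally.radialPart_ne_zero
    (horth : MeetsBoundaryCircleOrthogonally P Q) (hsys : IsPolynomialSystem n P Q)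
    (hsing : IsProjectivelySingular n P Q) {ω : Plane} (hω : ‖ω‖ = 1) :
    radialPart n P Q 0 ω ≠ 0 := by
  obtain ⟨Φ, hΦ, htraj⟩ := horth
  have hrad := hsys.radial_ne_zero hsing
  have heq : EqOn Φ (discField n P Q) projectiveDisc := by
    refine hΦ.eqOn_discField hsys.degree_left hsys.degree_right hsing ?_
    by_contra! hcon
    refine hrad ((isHomogeneous_radial n P Q).eq_zero_of_unit fun u hu => ?_)
    have h1 := congrArg (fun q : Space => q 2) (hcon _ (boundaryPoint_mem hu))
    rw [discField_boundaryPoint] at h1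
    rw [← radialPart_zero]
    simpa using h1
  -- Only transversal points are known to carry a trajectory, so orthogonality gives the vanishing
  -- of the product rather than of the angular factor.
  have hprod : ∀ u : Plane, ‖u‖ = 1 → radialPart n P Q 0 u * angularPart n P Q 0 u = 0 := by
    intro u hu
    by_cases hu0 : radialPart n P Q 0 u = 0
    · rw [hu0, zero_mul]
    have h2 : discField n P Q (boundaryPoint u) 2 ≠ 0 := by
      rw [discField_boundaryPoint]
      simpa using hu0
    obtain ⟨I, γ, hγ, h0, hγ0, hder⟩ := exists_discTrajectory heq (boundaryPoint_mem hu) h2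
    have h3 := (htraj I γ hγ 0 h0 (hγ0 ▸ boundaryPoint_mem hu)).2
    rw [hder, hγ0, discField_boundaryPoint, inner_space] at h3
    simp [circleTangent, boundaryPoint] at h3
    have h4 := sum_sq_eq_one hu
    have h5 : angularPart n P Q 0 u = 0 := by
      linear_combination h3 - angularPart n P Q 0 u * h4
    rw [h5, mul_zero]
  have hang : ∀ u : Plane, angularPart n P Q 0 u = 0 := by
    intro u
    rcases n with _ | n
    · simp [angularPart]
    have hhom : (X 0 * homogeneousComponent n Q - X 1 * homogeneousComponent n P :
        MvPolynomial (Fin 2) ℝ).IsHomogeneous (1 + n) :=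
      ((isHomogeneous_X _ _).mul (homogeneousComponent_isHomogeneous _ _)).sub
        ((isHomogeneous_X _ _).mul (homogeneousComponent_isHomogeneous _ _))
    -- The product is homogeneous and vanishes on the circle, so it is the zero polynomial; in a
    -- domain the nonzero radial factor cancels.
    have hz := ((isHomogeneous_radial (n + 1) P Q).mul hhom).eq_zero_of_unit fun u hu => by
      rw [map_mul, ← radialPart_zero, ← angularPart_zero]
      exact hprod u hu
    rw [angularPart_zero, (mul_eq_zero.1 hz).resolve_left hrad, map_zero]
  intro hzero
  have hp := boundaryPoint_mem hω
  have hfield : Φ (boundaryPoint ω) = 0 := by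
    rw [heq ⟨hp.1, hp.2.ge⟩, discField_boundaryPoint, hang, hzero]
    ext i
    fin_cases i <;> simp
  -- A zero of the radial part is now an equilibrium on the circle, and its constant trajectory has
  -- velocity 0.
  have hconst : IsDiscTrajectory Φ univ fun _ => boundaryPoint ω := by
    refine ⟨ordConnected_univ, nontrivial_univ, fun _ _ => ⟨hp.1, hp.2.ge⟩, fun t _ => ?_⟩
    change HasDerivWithinAt _ (Φ (boundaryPoint ω)) _ _
    rw [hfield]
    exact hasDerivWithinAt_const _ _ _
  refine (htraj univ _ hconst 0 (mem_univ _) hp).1 ?_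
  simp

end

theorem mainTheorem6 (n : ℕ) (P Q : MvPolynomial (Fin 2) ℝ)
    (hsystem : IsPolynomialSystem n P Q)
    (hsingular : IsProjectivelySingular n P Q)
    (horthogonal : MeetsBoundaryCircleOrthogonally P Q) :
    IsDicriticalNodeAtInfinity P Q :=
  isDicriticalNodeAtInfinity_of_radialPart_ne_zero hsystem.degree_left hsystem.degree_right
    hsingular fun _ hω => horthogonal.radialPart_ne_zero hsystem hsingular hω
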